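/- Let $k$ be a commutative ring and let $\mathcal A,\mathcal B$ be semifree dg categories over $k$, i.e. small $k$-linear dg categories $\mathcal C$ admitting a set of homogeneous generating morphisms $\{f_i\}$, indexed by an ordinal, such that the composites of composable words in the $f_i$ (including the empty words, i.e. the identities) form a $k$-basis of the morphisms of $\mathcal C$, and each $df_i$ is a $k$-linear combination of words in $\{f_j\mid j<i\}$. Fix such generating sets for $\mathcal A$ and $\mathcal B$. For such a $\mathcal C$, the cylinder $\mathrm{Cyl}(\mathcal C)$ is the semifree dg category with objects $C^1,C^2$ for each object $C$ of $\mathcal C$, freely generated by morphisms $f^1\colon A^1\to B^1$, $f^2\colon A^2\to B^2$ (of degree $|f|$) and $t_f\colon A^1\to B^2$ (of degree $|f|-1$) for each generating morphism $f\colon A\to B$ of $\mathcal C$, and, for each object $C$, by $$t_C\colon C^1\to C^2,\quad t'_C\colon C^2\to C^1,\quad \hat t_C\colon C^1\to C^1,\quad \check t_C\colon C^2\to C^2,\quad \bar t_C\colon C^1\to C^2$$ of degrees $0,0,-1,-1,-2$. Its differential is given by $df^r=(df)^r$ for $r=1,2$, $dt_C=dt'_C=0$, $d\hat t_C=1_{C^1}-t'_C\circ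 t_C$, $d\check t_C=1_{C^2}-t_C\circ t'_C$, $d\bar t_C=t_C\circ\hat t_C-\check t_C\circ t_C$, and $$dt_f=(-1)^{|f|}\bigl(f^2\circ t_A-t_B\circ f^1\bigr)+t_{df},$$ where $i_r\colon\mathcal C\to\mathrm{Cyl}(\mathcal C)$, $C\mapsto C^r$, $f\mapsto f^r$ ($r=1,2$) are the inclusion dg functors, $\theta^r:=i_r(\theta)$ for every morphism $\theta$ of $\mathcal C$, and $t_\theta$ is $k$-linear in $\theta$ with $t_{1_A}=0$ and $$t_{f_n\circ\cdots\circ f_1}=\sum_{j=1}^n(-1)^{|f_{j-1}|+\cdots+|f_1|}\,f_n^2\circ\cdots\circ f_{j+1}^2\circ t_{f_j}\circ f_{j-1}^1\circ\cdots\circ f_1^1$$ for generating morphisms $f_1,\dots,f_n$. Two dg functors $F_1,F_2\colon\mathcal C\to\mathcal D$, with $\mathcal C$ and $\mathcal D$ semifree, are called homotopic, $F_1\approx F_2$, if there is a dg functor $H\colon\mathrm{Cyl}(\mathcal C)\to\mathcal D$ with $H\circ i_1=F_1$ and $H\circ i_2=F_2$. A dg functor $F\colon\mathcal A\to\mathcal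 B$ is a homotopy equivalence if there is a dg functor $G\colon\mathcal B\to\mathcal A$ with $G\circ F\approx 1_{\mathcal A}$ and $F\circ G\approx 1_{\mathcal B}$. It is a quasi-equivalence if it induces isomorphisms $H^n(\hom_{\mathcal A}(A,A'))\to H^n(\hom_{\mathcal B}(FA,FA'))$ for all objects $A,A'$ of $\mathcal A$ and all $n\in\mathbb Z$, and $H^0(F)\colon H^0(\mathcal A)\to H^0(\mathcal B)$ is essentially surjective. **Theorem.** A dg functor $F\colon\mathcal A\to\mathcal B$ between semifree dg categories is a homotopy equivalence if and only if it is a quasi-equivalence. -/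

import Mathlib

open CategoryTheory

universe w v u w₁ w₂ v₁ v₂ u₁ u₂ u₃

namespace DG

/-! ### dg categories and dg functors -/

/-- A `k`-linear dg category.  The morphism complex from `X` to `Y` is given by its total module
`X ⟶ Y = ⨁ n, hom^n (X, Y)`, with an internal `ℤ`-grading and a differential of degree `1`.
Composition is written in diagrammatic order, `f ≫ g = g ∘ f`, so that the graded Leibniz rule
`d (g ∘ f) = dg ∘ f + (-1)^|g| g ∘ df` takes the form of the field `leibniz`. -/
class DGCategory (k : Type*) [CommRing k] (C : Type u) [Category.{v} C] [Preadditive C]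
    [Linear k C] where
  /-- `grading X Y n` is the module of morphisms of degree `n`. -/
  grading : ∀ X Y : C, ℤ → Submodule k (X ⟶ Y)
  isInternal : ∀ X Y : C, DirectSum.IsInternal (grading X Y)
  id_mem : ∀ X : C, 𝟙 X ∈ grading X X 0
  comp_mem : ∀ {X Y Z : C} {m n : ℤ} {f : X ⟶ Y} {g : Y ⟶ Z},
    f ∈ grading X Y m → g ∈ grading Y Z n → f ≫ g ∈ grading X Z (m + n)
  /-- The differential. -/
  d : ∀ X Y : C, (X ⟶ Y) →ₗ[k] (X ⟶ Y)
  d_mem : ∀ {X Y : C} {n : ℤ} {f : X ⟶ Y}, f ∈ grading X Y n → d X Y f ∈ grading X Y (n + 1)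
  d_d : ∀ {X Y : C} (f : X ⟶ Y), d X Y (d X Y f) = 0
  leibniz : ∀ {X Y Z : C} {n : ℤ} (f : X ⟶ Y) {g : Y ⟶ Z}, g ∈ grading Y Z n →
    d X Z (f ≫ g) = f ≫ d Y Z g + n.negOnePow • (d X Y f ≫ g)

/-- A dg functor: a `k`-linear functor that preserves degrees and commutes with differentials. -/
structure DGFunctor (k : Type*) [CommRing k]
    (C : Type*) [Category* C] [Preadditive C] [Linear k C] [DGCategory k C]
    (D : Type*) [Category* D] [Preadditive D] [Linear k D] [DGCategory k D]
    extends C ⥤ D where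
  map_add : ∀ {X Y : C} (f g : X ⟶ Y), map (f + g) = map f + map g
  map_smul : ∀ {X Y : C} (a : k) (f : X ⟶ Y), map (a • f) = a • map f
  map_mem : ∀ {X Y : C} {n : ℤ} {f : X ⟶ Y}, f ∈ DGCategory.grading (k := k) X Y n →
    map f ∈ DGCategory.grading (k := k) (obj X) (obj Y) n
  map_d : ∀ {X Y : C} (f : X ⟶ Y),
    map (DGCategory.d (k := k) X Y f) = DGCategory.d (k := k) (obj X) (obj Y) (map f)

/-! ### Cohomology and quasi-equivalences -/

/-- The objects of the category `Z^0 (C)` of closed morphisms of degree zero. -/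
structure Z0 (k : Type*) (C : Type u) where
  obj : C

section Cohomology

variable (k : Type*) [CommRing k] {C : Type u} [Category.{v} C] [Preadditive C] [Linear k C]
  [DGCategory k C]

/-- Closed morphisms of degree `n`. -/
def cocycles (X Y : C) (n : ℤ) : Submodule k (X ⟶ Y) :=
  DGCategory.grading X Y n ⊓ LinearMap.ker (DGCategory.d X Y)

/-- Exact morphisms of degree `n`. -/
def coboundaries (X Y : C) (n : ℤ) : Submodule k (X ⟶ Y) :=
  (DGCategory.grading X Y (n - 1)).map (DGCategory.d X Y)

/-- `H^n (hom (X, Y))`. -/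
abbrev Cohomology (X Y : C) (n : ℤ) : Type _ :=
  cocycles k X Y n ⧸ (coboundaries k X Y n).submoduleOf (cocycles k X Y n)

theorem id_mem_cocycles (X : C) : 𝟙 X ∈ cocycles k X X 0 := by
  refine ⟨DGCategory.id_mem X, ?_⟩
  have h := DGCategory.leibniz (k := k) (𝟙 X) (DGCategory.id_mem (k := k) X)
  simpa using h

theorem comp_mem_cocycles {X Y Z : C} {f : X ⟶ Y} {g : Y ⟶ Z} (hf : f ∈ cocycles k X Y 0)
    (hg : g ∈ cocycles k Y Z 0) : f ≫ g ∈ cocycles k X Z 0 := by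
  refine ⟨by simpa using DGCategory.comp_mem hf.1 hg.1, ?_⟩
  have h := DGCategory.leibniz (k := k) f hg.1
  have h1 : DGCategory.d (k := k) X Y f = 0 := hf.2
  have h2 : DGCategory.d (k := k) Y Z g = 0 := hg.2
  simpa [h1, h2] using h

instance : Category (Z0 k C) where
  Hom X Y := cocycles k X.obj Y.obj 0
  id X := ⟨𝟙 X.obj, id_mem_cocycles k X.obj⟩
  comp f g := ⟨f.1 ≫ g.1, comp_mem_cocycles k f.2 g.2⟩
  id_comp f := Subtype.ext (Category.id_comp f.1)
  comp_id f := Subtype.ext (Category.comp_id f.1)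
  assoc f g h := Subtype.ext (Category.assoc f.1 g.1 h.1)

variable (C) in
/-- Two closed morphisms of degree zero are cohomologous. -/
def cohomologous : HomRel (Z0 k C) :=
  fun X Y f g => f.1 - g.1 ∈ coboundaries k X.obj Y.obj 0

instance : Congruence (cohomologous k C) where
  equivalence :=
    { refl := fun f => by simp [cohomologous]
      symm := fun {f g} h => by
        have := (coboundaries k _ _ 0).neg_mem h
        simpa [cohomologous] using this
      trans := fun {f g e} h h' => by
        have := (coboundaries k _ _ 0).add_mem h h'
        simpa [cohomologous] using this }
  comp_left := by
    rintro X Y Z f g g' ⟨a, ha, hd⟩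
    refine ⟨f.1 ≫ a, by simpa using DGCategory.comp_mem f.2.1 ha, ?_⟩
    have h1 : DGCategory.d (k := k) _ _ f.1 = 0 := f.2.2
    rw [DGCategory.leibniz f.1 ha, hd, h1]
    change f.1 ≫ (g.1 - g'.1) + _ = f.1 ≫ g.1 - f.1 ≫ g'.1
    simp
  comp_right := by
    rintro X Y Z f f' g ⟨a, ha, hd⟩
    refine ⟨a ≫ g.1, by simpa using DGCategory.comp_mem ha g.2.1, ?_⟩
    have h1 : DGCategory.d (k := k) _ _ g.1 = 0 := g.2.2
    rw [DGCategory.leibniz a g.2.1, hd, h1]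
    change _ + Int.negOnePow 0 • ((f.1 - f'.1) ≫ g.1) = f.1 ≫ g.1 - f'.1 ≫ g.1
    simp

variable (C) in
/-- The category `H^0 (C)`. -/
abbrev H0 : Type _ := CategoryTheory.Quotient (cohomologous k C)

end Cohomology

namespace DGFunctor

variable {k : Type*} [CommRing k]
  {C : Type*} [Category* C] [Preadditive C] [Linear k C] [DGCategory k C]
  {D : Type*} [Category* D] [Preadditive D] [Linear k D] [DGCategory k D]
  {E : Type*} [Category* E] [Preadditive E] [Linear k E] [DGCategory k E]

variable (k C) in
/-- The identity dg functor. -/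
def id : DGFunctor k C C where
  toFunctor := 𝟭 C
  map_add _ _ := rfl
  map_smul _ _ := rfl
  map_mem h := h
  map_d _ := rfl

/-- The composite of two dg functors: first `F`, then `G`. -/
def comp (F : DGFunctor k C D) (G : DGFunctor k D E) : DGFunctor k C E where
  toFunctor := F.toFunctor ⋙ G.toFunctor
  map_add f g := by simp [F.map_add, G.map_add]
  map_smul a f := by simp [F.map_smul, G.map_smul]
  map_mem h := G.map_mem (F.map_mem h)
  map_d f := by simp [F.map_d, G.map_d]

variable (F : DGFunctor k C D)

/-- The action of a dg functor on morphisms, as a linear map. -/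
def mapLinear (X Y : C) : (X ⟶ Y) →ₗ[k] (F.obj X ⟶ F.obj Y) where
  toFun := F.map
  map_add' := F.map_add
  map_smul' := F.map_smul

theorem map_mem_cocycles {X Y : C} {n : ℤ} {f : X ⟶ Y} (hf : f ∈ cocycles k X Y n) :
    F.mapLinear X Y f ∈ cocycles k (F.obj X) (F.obj Y) n := by
  refine ⟨F.map_mem hf.1, ?_⟩
  have h1 : DGCategory.d (k := k) X Y f = 0 := hf.2
  have h2 := F.map_d f
  rw [h1] at h2
  exact h2.symm.trans (map_zero (F.mapLinear X Y))

theorem map_mem_coboundaries {X Y : C} {n : ℤ} {f : X ⟶ Y} (hf : f ∈ coboundaries k X Y n) :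
    F.mapLinear X Y f ∈ coboundaries k (F.obj X) (F.obj Y) n := by
  obtain ⟨a, ha, rfl⟩ := hf
  exact ⟨F.map a, F.map_mem ha, (F.map_d a).symm⟩

/-- The map `H^n (hom (X, Y)) → H^n (hom (F X, F Y))` induced by `F`. -/
def mapCohomology (X Y : C) (n : ℤ) :
    Cohomology k X Y n →ₗ[k] Cohomology k (F.obj X) (F.obj Y) n :=
  Submodule.mapQ _ _
    ((F.mapLinear X Y).restrict (fun _ h => F.map_mem_cocycles h) :
      cocycles k X Y n →ₗ[k] cocycles k (F.obj X) (F.obj Y) n)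
    (fun _ h => F.map_mem_coboundaries h)

/-- The functor `Z^0 (F)`. -/
def mapZ0 : Z0 k C ⥤ Z0 k D where
  obj X := ⟨F.obj X.obj⟩
  map f := ⟨F.map f.1, F.map_mem_cocycles f.2⟩
  map_id X := Subtype.ext (F.map_id X.obj)
  map_comp f g := Subtype.ext (F.map_comp f.1 g.1)

/-- The functor `H^0 (F)`. -/
def mapH0 : H0 k C ⥤ H0 k D :=
  CategoryTheory.Quotient.lift _ (F.mapZ0 ⋙ CategoryTheory.Quotient.functor _) (by
    intro X Y f g h
    apply CategoryTheory.Quotient.sound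
    have h1 := F.map_mem_coboundaries h
    rwa [map_sub] at h1)

/-- `F` is a quasi-equivalence: it induces isomorphisms on the cohomology of all morphism
complexes, and `H^0 (F)` is essentially surjective. -/
structure IsQuasiEquivalence : Prop where
  bijective : ∀ (X Y : C) (n : ℤ), Function.Bijective (F.mapCohomology X Y n)
  essSurj : F.mapH0.EssSurj

end DGFunctor

/-! ### Words in a graded quiver and the free graded category -/

/-- A graded quiver with set of vertices `O`. -/
structure GradedQuiver (O : Type u) where
  Gen : O → O → Type w
  deg : ∀ {X Y : O}, Gen X Y → ℤ

namespace GradedQuiver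

variable {O : Type u}

/-- Words of composable arrows; `cons p e` is `e ∘ p`. -/
inductive Word (Q : GradedQuiver.{w} O) (X : O) : O → Type (max u w)
  | nil : Word Q X X
  | cons {Y Z : O} (p : Word Q X Y) (e : Q.Gen Y Z) : Word Q X Z

namespace Word

variable {Q : GradedQuiver.{w} O}

/-- Concatenation of words: first `p`, then `q`. -/
def comp {X Y : O} (p : Q.Word X Y) : ∀ {Z : O}, Q.Word Y Z → Q.Word X Z
  | _, nil => p
  | _, cons q e => cons (comp p q) e

/-- The one-letter word. -/
def single {X Y : O} (e : Q.Gen X Y) : Q.Word X Y := cons nil e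

/-- The degree of a word. -/
def degree {X : O} : ∀ {Y : O}, Q.Word X Y → ℤ
  | _, nil => 0
  | _, cons p e => degree p + Q.deg e

/-- All letters of a word have the property `P`. -/
def All (P : ∀ {X Y : O}, Q.Gen X Y → Prop) {X : O} : ∀ {Y : O}, Q.Word X Y → Prop
  | _, nil => True
  | _, cons p e => All P p ∧ P e

/-- The composite, in a category with set of objects `O`, of the letters of a word. -/
def eval {C : Type u} [Category.{v} C] {Q : GradedQuiver.{w} C}
    (val : ∀ {X Y : C}, Q.Gen X Y → (X ⟶ Y)) {X : C} : ∀ {Y : C}, Q.Word X Y → (X ⟶ Y)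
  | _, nil => 𝟙 X
  | _, cons p e => eval val p ≫ val e

@[simp] theorem comp_nil {X Y : O} (p : Q.Word X Y) : p.comp nil = p := rfl

@[simp] theorem comp_cons {X Y Z W : O} (p : Q.Word X Y) (q : Q.Word Y Z) (e : Q.Gen Z W) :
    p.comp (cons q e) = cons (p.comp q) e := rfl

@[simp] theorem nil_comp {X Y : O} (p : Q.Word X Y) : (nil : Q.Word X X).comp p = p := by
  induction p with
  | nil => rfl
  | cons p e ih => rw [comp_cons, ih]

theorem comp_assoc {X Y Z W : O} (p : Q.Word X Y) (q : Q.Word Y Z) (r : Q.Word Z W) :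
    (p.comp q).comp r = p.comp (q.comp r) := by
  induction r with
  | nil => rfl
  | cons r e ih => simp only [comp_cons, ih]

theorem degree_comp {X Y Z : O} (p : Q.Word X Y) (q : Q.Word Y Z) :
    (p.comp q).degree = p.degree + q.degree := by
  induction q with
  | nil => simp [degree]
  | cons q e ih => simp [degree, ih, add_assoc]

theorem eval_comp {C : Type u} [Category.{v} C] {Q : GradedQuiver.{w} C}
    (val : ∀ {X Y : C}, Q.Gen X Y → (X ⟶ Y)) {X Y Z : C} (p : Q.Word X Y) (q : Q.Word Y Z) :
    (p.comp q).eval val = p.eval val ≫ q.eval val := by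
  induction q with
  | nil => simp [eval]
  | cons q e ih => simp [eval, ih]

end Word

variable (k : Type*) [CommRing k] (Q : GradedQuiver.{w} O)

/-- Morphisms of the free `k`-linear category: formal `k`-linear combinations of words. -/
abbrev Lin (X Y : O) : Type _ := Q.Word X Y →₀ k

variable {Q}

/-- A word as a morphism of the free `k`-linear category. -/
noncomputable def word {X Y : O} (p : Q.Word X Y) : Q.Lin k X Y := Finsupp.single p 1

variable (Q) in
/-- The submodule spanned by the words of degree `n`. -/
def homog (X Y : O) (n : ℤ) : Submodule k (Q.Lin k X Y) :=
  Finsupp.supported k k {p | p.degree = n}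

variable {k}

/-- Composition in the free `k`-linear category, in diagrammatic order. -/
noncomputable def mul {X Y Z : O} : Q.Lin k X Y →ₗ[k] Q.Lin k Y Z →ₗ[k] Q.Lin k X Z :=
  Finsupp.linearCombination k fun p => Finsupp.lmapDomain k k fun q => p.comp q

@[simp] theorem mul_word {X Y Z : O} (p : Q.Word X Y) (q : Q.Word Y Z) :
    mul (word k p) (word k q) = word k (p.comp q) := by
  simp [mul, word]

/-- Two linear maps that agree on words are equal. -/
theorem lin_ext {M : Type*} [AddCommGroup M] [Module k M] {X Y : O} {f g : Q.Lin k X Y →ₗ[k] M}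
    (h : ∀ p, f (word k p) = g (word k p)) : f = g :=
  Finsupp.lhom_ext' fun p => LinearMap.ext_ring (h p)

theorem lin_ext_apply {M : Type*} [AddCommGroup M] [Module k M] {X Y : O}
    {f g : Q.Lin k X Y →ₗ[k] M} (h : ∀ p, f (word k p) = g (word k p)) (x : Q.Lin k X Y) :
    f x = g x := by rw [lin_ext h]

theorem homog_eq_span (X Y : O) (n : ℤ) :
    Q.homog k X Y n = Submodule.span k ((word k) '' {p | p.degree = n}) :=
  Finsupp.supported_eq_span_single k _

theorem homog_ext {M : Type*} [AddCommGroup M] [Module k M] {X Y : O} {n : ℤ}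
    {f g : Q.Lin k X Y →ₗ[k] M} (h : ∀ p : Q.Word X Y, p.degree = n → f (word k p) = g (word k p))
    {x : Q.Lin k X Y} (hx : x ∈ Q.homog k X Y n) : f x = g x := by
  rw [homog_eq_span] at hx
  refine LinearMap.eqOn_span (R := k) ?_ hx
  rintro _ ⟨p, hp, rfl⟩
  exact h p hp

theorem homog_le {X Y : O} {n : ℤ} {M : Type*} [AddCommGroup M] [Module k M]
    {f : Q.Lin k X Y →ₗ[k] M} {N : Submodule k M}
    (h : ∀ p : Q.Word X Y, p.degree = n → f (word k p) ∈ N)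
    {x : Q.Lin k X Y} (hx : x ∈ Q.homog k X Y n) : f x ∈ N := by
  rw [homog_eq_span] at hx
  have : Submodule.span k ((word k) '' {p : Q.Word X Y | p.degree = n}) ≤ N.comap f := by
    rw [Submodule.span_le]
    rintro _ ⟨p, hp, rfl⟩
    exact h p hp
  exact this hx

theorem word_mem {X Y : O} (p : Q.Word X Y) : word k p ∈ Q.homog k X Y p.degree :=
  Finsupp.single_mem_supported k 1 rfl

theorem mul_mem {X Y Z : O} {m n : ℤ} {x : Q.Lin k X Y} {y : Q.Lin k Y Z}
    (hx : x ∈ Q.homog k X Y m) (hy : y ∈ Q.homog k Y Z n) : mul x y ∈ Q.homog k X Z (m + n) := by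
  refine homog_le (f := mul.flip y) (fun p hp => ?_) hx
  refine homog_le (f := mul (word k p)) (fun q hq => ?_) hy
  rw [mul_word, ← hp, ← hq, ← Word.degree_comp]
  exact word_mem _

theorem mul_assoc {X Y Z W : O} (x : Q.Lin k X Y) (y : Q.Lin k Y Z) (z : Q.Lin k Z W) :
    mul (mul x y) z = mul x (mul y z) := by
  refine lin_ext_apply (f := (mul.flip z).comp (mul.flip y)) (g := mul.flip (mul y z))
    (fun p => ?_) x
  refine lin_ext_apply (f := (mul.flip z).comp (mul (word k p)))
    (g := (mul (word k p)).comp (mul.flip z)) (fun q => ?_) y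
  refine lin_ext_apply (f := mul (mul (word k p) (word k q)))
    (g := (mul (word k p)).comp (mul (word k q))) (fun r => ?_) z
  simp [Word.comp_assoc]

@[simp] theorem one_mul {X Y : O} (x : Q.Lin k X Y) : mul (word k .nil) x = x :=
  lin_ext_apply (f := mul (word k .nil)) (g := LinearMap.id) (fun p => by simp) x

@[simp] theorem mul_one {X Y : O} (x : Q.Lin k X Y) : mul x (word k .nil) = x :=
  lin_ext_apply (f := mul.flip (word k .nil)) (g := LinearMap.id) (fun p => by simp) x

theorem homog_isInternal (X Y : O) : DirectSum.IsInternal (Q.homog k X Y) := by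
  rw [DirectSum.isInternal_submodule_iff_iSupIndep_and_iSup_eq_top]
  constructor
  · intro n
    have h : (⨆ m, ⨆ (_ : m ≠ n), Q.homog k X Y m) ≤
        Finsupp.supported k k {p : Q.Word X Y | p.degree ≠ n} := by
      refine iSup₂_le fun m hm => Finsupp.supported_mono ?_
      rintro p rfl
      exact hm
    refine Disjoint.mono_right h (Finsupp.disjoint_supported_supported ?_)
    rw [Set.disjoint_left]
    intro p hp hp'
    exact hp' hp
  · unfold homog
    rw [← Finsupp.supported_iUnion, ← Finsupp.supported_univ]
    congr
    ext p
    simp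

/-- The extension of `dGen`, given on arrows, to all words by the Leibniz rule
`d (e ∘ p) = de ∘ p + (-1)^|e| e ∘ dp`. -/
noncomputable def leibnizWord (dGen : ∀ {X Y : O}, Q.Gen X Y → Q.Lin k X Y) {X : O} :
    ∀ {Y : O}, Q.Word X Y → Q.Lin k X Y
  | _, .nil => 0
  | _, .cons p e => mul (word k p) (dGen e) +
      (Q.deg e).negOnePow • mul (leibnizWord dGen p) (word k (.single e))

/-- The linear extension of `leibnizWord`. -/
noncomputable def leibnizExt (dGen : ∀ {X Y : O}, Q.Gen X Y → Q.Lin k X Y) (X Y : O) :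
    Q.Lin k X Y →ₗ[k] Q.Lin k X Y :=
  Finsupp.linearCombination k (leibnizWord dGen)

@[simp] theorem leibnizExt_word (dGen : ∀ {X Y : O}, Q.Gen X Y → Q.Lin k X Y) {X Y : O}
    (p : Q.Word X Y) : leibnizExt dGen X Y (word k p) = leibnizWord dGen p := by
  simp [leibnizExt, word]

end GradedQuiver

/-! ### Semifree dg categories given by generators -/

open GradedQuiver

/-- A graded quiver with a differential on the free `k`-linear graded category on it, specified by
its values on the arrows. -/
structure DGQuiver (k : Type*) [CommRing k] (O : Type u) extends GradedQuiver.{w} O where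
  dGen : ∀ {X Y : O}, Gen X Y → toGradedQuiver.Lin k X Y
  dGen_mem : ∀ {X Y : O} (e : Gen X Y), dGen e ∈ toGradedQuiver.homog k X Y (deg e + 1)
  d_dGen : ∀ {X Y : O} (e : Gen X Y), leibnizExt dGen X Y (dGen e) = 0

namespace DGQuiver

variable {k : Type*} [CommRing k] {O : Type u} (D : DGQuiver.{w} k O)

/-- The differential of the free dg category on `D`. -/
noncomputable abbrev diff (X Y : O) : D.Lin k X Y →ₗ[k] D.Lin k X Y := leibnizExt D.dGen X Y

end DGQuiver

namespace GradedQuiver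

variable {k : Type*} [CommRing k] {O : Type u} {Q : GradedQuiver.{w} O}

theorem word_cons {X Y Z : O} (p : Q.Word X Y) (e : Q.Gen Y Z) :
    word k (p.cons e) = mul (word k p) (word k (.single e)) := by
  rw [mul_word]; rfl

theorem word_single_mem {X Y : O} (e : Q.Gen X Y) :
    word k (Word.single e) ∈ Q.homog k X Y (Q.deg e) := by
  have h := word_mem (k := k) (Word.single e)
  simpa [Word.single, Word.degree] using h

variable (dGen : ∀ {X Y : O}, Q.Gen X Y → Q.Lin k X Y)

theorem leibnizWord_single {X Y : O} (e : Q.Gen X Y) :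
    leibnizWord dGen (Word.single e) = dGen e := by
  simp [Word.single, leibnizWord]

theorem leibnizWord_comp {X Y Z : O} (p : Q.Word X Y) (q : Q.Word Y Z) :
    leibnizWord dGen (p.comp q) = mul (word k p) (leibnizWord dGen q) +
      q.degree.negOnePow • mul (leibnizWord dGen p) (word k q) := by
  induction q with
  | nil => simp [leibnizWord, Word.degree]
  | cons q e ih =>
    rw [Word.comp_cons, leibnizWord, ih, leibnizWord, word_cons q e, ← mul_word]
    simp only [Word.degree, Int.negOnePow_add, Units.smul_def, map_add, map_zsmul,
      LinearMap.add_apply, LinearMap.smul_apply, mul_assoc, mul_smul, smul_add]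
    rw [smul_comm (q.degree.negOnePow : ℤ)]
    abel

/-- The Leibniz rule for the extended differential. -/
theorem leibnizExt_mul {X Y Z : O} {n : ℤ} (x : Q.Lin k X Y) {y : Q.Lin k Y Z}
    (hy : y ∈ Q.homog k Y Z n) :
    leibnizExt dGen X Z (mul x y) = mul x (leibnizExt dGen Y Z y) +
      n.negOnePow • mul (leibnizExt dGen X Y x) y := by
  refine lin_ext_apply (f := (leibnizExt dGen X Z).comp (mul.flip y))
    (g := mul.flip (leibnizExt dGen Y Z y) +
      (n.negOnePow : ℤ) • (mul.flip y).comp (leibnizExt dGen X Y)) (fun p => ?_) x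
  refine homog_ext (f := (leibnizExt dGen X Z).comp (mul (word k p)))
    (g := (mul (word k p)).comp (leibnizExt dGen Y Z) +
      (n.negOnePow : ℤ) • mul (leibnizExt dGen X Y (word k p))) (fun q hq => ?_) hy
  subst hq
  simp [leibnizWord_comp, Units.smul_def]

theorem leibnizExt_mem (h : ∀ {X Y : O} (e : Q.Gen X Y), dGen e ∈ Q.homog k X Y (Q.deg e + 1))
    {X Y : O} {n : ℤ} {x : Q.Lin k X Y} (hx : x ∈ Q.homog k X Y n) :
    leibnizExt dGen X Y x ∈ Q.homog k X Y (n + 1) := by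
  refine homog_le (fun p hp => ?_) hx
  subst hp
  rw [leibnizExt_word]
  induction p with
  | nil => simp [leibnizWord]
  | cons p e ih =>
    rw [leibnizWord]
    refine Submodule.add_mem _ ?_ ?_
    · have := mul_mem (word_mem p) (h e)
      rw [Word.degree]
      rwa [← add_assoc] at this
    · rw [Units.smul_def]
      refine zsmul_mem ?_ _
      have := mul_mem (ih (word_mem p)) (word_single_mem (k := k) e)
      rw [Word.degree]
      rwa [add_right_comm] at this

theorem leibnizExt_leibnizExt
    (hm : ∀ {X Y : O} (e : Q.Gen X Y), dGen e ∈ Q.homog k X Y (Q.deg e + 1))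
    (h : ∀ {X Y : O} (e : Q.Gen X Y), leibnizExt dGen X Y (dGen e) = 0)
    {X Y : O} (x : Q.Lin k X Y) : leibnizExt dGen X Y (leibnizExt dGen X Y x) = 0 := by
  refine lin_ext_apply (f := (leibnizExt dGen X Y).comp (leibnizExt dGen X Y)) (g := 0)
    (fun p => ?_) x
  rw [LinearMap.comp_apply, leibnizExt_word, LinearMap.zero_apply]
  induction p with
  | nil => simp [leibnizWord]
  | cons p e ih =>
    have h1 := leibnizExt_mul dGen (word k p) (hm e)
    have h2 := leibnizExt_mul dGen (leibnizWord dGen p) (word_single_mem (k := k) e)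
    rw [leibnizWord, map_add, h1, Units.smul_def, Units.smul_def, map_zsmul, h2, h,
      ih (word k p)]
    simp [leibnizWord_single, Int.negOnePow_succ]

end GradedQuiver

/-- The (objects of the) free dg category on `D`: its morphisms are the `k`-linear combinations of
words in the arrows of `D`, and its differential is the one specified on arrows by `D`. -/
structure FreeDG {k : Type*} [CommRing k] {O : Type u} (D : DGQuiver.{w} k O) where
  obj : O

namespace FreeDG

variable {k : Type*} [CommRing k] {O : Type u} (D : DGQuiver.{w} k O)

noncomputable instance : Category (FreeDG D) where
  Hom X Y := D.Lin k X.obj Y.obj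
  id _ := word k .nil
  comp f g := mul f g
  id_comp f := GradedQuiver.one_mul f
  comp_id f := GradedQuiver.mul_one f
  assoc f g h := GradedQuiver.mul_assoc f g h

noncomputable instance : Preadditive (FreeDG D) where
  homGroup X Y := inferInstanceAs (AddCommGroup (D.Lin k X.obj Y.obj))
  add_comp _ _ _ f f' g := LinearMap.map_add₂ mul f f' g
  comp_add _ _ _ f g g' := (mul (Q := D.toGradedQuiver) f).map_add g g'

noncomputable instance : Linear k (FreeDG D) where
  homModule X Y := inferInstanceAs (Module k (D.Lin k X.obj Y.obj))
  smul_comp _ _ _ a f g := LinearMap.map_smul₂ mul a f g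
  comp_smul _ _ _ f a g := (mul (Q := D.toGradedQuiver) f).map_smul a g

noncomputable instance : DGCategory k (FreeDG D) where
  grading X Y n := D.homog k X.obj Y.obj n
  isInternal X Y := homog_isInternal X.obj Y.obj
  id_mem _ := word_mem .nil
  comp_mem hf hg := mul_mem hf hg
  d X Y := D.diff X.obj Y.obj
  d_mem h := leibnizExt_mem D.dGen D.dGen_mem h
  d_d f := leibnizExt_leibnizExt D.dGen D.dGen_mem D.d_dGen f
  leibniz f _ hg := leibnizExt_mul D.dGen f hg

end FreeDG

/-- A set of generating morphisms of a dg category `C`, exhibiting it as a semifree dg category: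
the composites of words in the generators form a `k`-basis of every morphism module, the generators
are well-ordered, and the differential of each generator is generated by smaller ones. -/
structure SemifreeGenerators (k : Type*) [CommRing k] (C : Type u) [Category.{v} C]
    [Preadditive C] [Linear k C] [DGCategory k C] extends GradedQuiver.{w} C where
  /-- The morphism of `C` that a generator stands for. -/
  val : ∀ {X Y : C}, Gen X Y → (X ⟶ Y)
  val_mem : ∀ {X Y : C} (f : Gen X Y), val f ∈ DGCategory.grading (k := k) X Y (deg f)
  free : ∀ X Y : C, Function.Bijective
    (Finsupp.linearCombination k fun p : toGradedQuiver.Word X Y => p.eval val)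
  /-- The order of the generators. -/
  lt : (Σ X Y : C, Gen X Y) → (Σ X Y : C, Gen X Y) → Prop
  isWellOrder : IsWellOrder _ lt
  d_val_mem : ∀ {X Y : C} (f : Gen X Y), DGCategory.d (k := k) X Y (val f) ∈
    Submodule.span k ((fun p : toGradedQuiver.Word X Y => p.eval val) ''
      {p | p.All fun {U V} g => lt ⟨U, V, g⟩ ⟨X, Y, f⟩})

namespace SemifreeGenerators

variable {k : Type*} [CommRing k] {C : Type u} [Category.{v} C] [Preadditive C] [Linear k C]
  [DGCategory k C] (G : SemifreeGenerators.{w} k C)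

/-- The expansion of the morphisms of `C` as linear combinations of words in the generators. -/
noncomputable def expand (X Y : C) : (X ⟶ Y) ≃ₗ[k] G.Lin k X Y :=
  (LinearEquiv.ofBijective _ (G.free X Y)).symm

theorem expand_symm_word {X Y : C} (p : G.Word X Y) :
    (G.expand X Y).symm (word k p) = p.eval G.val := by
  simp [expand, word]

theorem expand_eval {X Y : C} (p : G.Word X Y) : G.expand X Y (p.eval G.val) = word k p := by
  rw [← expand_symm_word, LinearEquiv.apply_symm_apply]

theorem expand_symm_mul {X Y Z : C} (x : G.Lin k X Y) (y : G.Lin k Y Z) :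
    (G.expand X Z).symm (mul x y) = (G.expand X Y).symm x ≫ (G.expand Y Z).symm y := by
  refine lin_ext_apply (f := (G.expand X Z).symm.toLinearMap.comp (mul.flip y))
    (g := (Linear.rightComp k X ((G.expand Y Z).symm y)).comp (G.expand X Y).symm.toLinearMap)
    (fun p => ?_) x
  refine lin_ext_apply (f := (G.expand X Z).symm.toLinearMap.comp (mul (word k p)))
    (g := (Linear.leftComp k Z ((G.expand X Y).symm (word k p))).comp
      (G.expand Y Z).symm.toLinearMap) (fun q => ?_) y
  simp [expand_symm_word, Word.eval_comp]

theorem expand_comp {X Y Z : C} (f : X ⟶ Y) (g : Y ⟶ Z) :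
    G.expand X Z (f ≫ g) = mul (G.expand X Y f) (G.expand Y Z g) := by
  apply (G.expand X Z).symm.injective
  simp [expand_symm_mul]

theorem expand_id (X : C) : G.expand X X (𝟙 X) = word k .nil :=
  G.expand_eval (.nil : G.Word X X)

theorem eval_mem {X Y : C} (p : G.Word X Y) :
    p.eval G.val ∈ DGCategory.grading (k := k) X Y p.degree := by
  induction p with
  | nil => exact DGCategory.id_mem _
  | cons p e ih => exact DGCategory.comp_mem ih (G.val_mem e)

theorem expand_mem {X Y : C} {n : ℤ} {f : X ⟶ Y} (hf : f ∈ DGCategory.grading (k := k) X Y n) :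
    G.expand X Y f ∈ G.homog k X Y n := by
  classical
  obtain ⟨x, rfl⟩ := (G.expand X Y).symm.surjective f
  rw [LinearEquiv.apply_symm_apply]
  have hx : x.filter (fun p => p.degree = n) + x.filter (fun p => ¬ p.degree = n) = x :=
    Finsupp.filter_add_filter_not x _
  have hx1 : x.filter (fun p => p.degree = n) ∈ G.homog k X Y n := by
    rw [homog, Finsupp.mem_supported]
    intro p hp
    simp at hp
    exact hp.2
  have e1 : (G.expand X Y).symm (x.filter (fun p => p.degree = n)) ∈
      DGCategory.grading (k := k) X Y n := by
    refine homog_le (f := (G.expand X Y).symm.toLinearMap) (fun p hp => ?_) hx1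
    rw [LinearEquiv.coe_coe, expand_symm_word, ← hp]
    exact G.eval_mem p
  have e2 : (G.expand X Y).symm (x.filter (fun p => ¬ p.degree = n)) ∈
      DGCategory.grading (k := k) X Y n := by
    have : (G.expand X Y).symm (x.filter (fun p => ¬ p.degree = n)) =
        (G.expand X Y).symm x - (G.expand X Y).symm (x.filter (fun p => p.degree = n)) := by
      rw [← map_sub]
      congr 1
      exact eq_sub_of_add_eq' hx
    rw [this]
    exact sub_mem hf e1
  have e3 : (G.expand X Y).symm (x.filter (fun p => ¬ p.degree = n)) ∈
      ⨆ m, ⨆ (_ : m ≠ n), DGCategory.grading (k := k) X Y m := by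
    rw [← Finsupp.sum_single (x.filter (fun p => ¬ p.degree = n)), Finsupp.sum, map_sum]
    refine Submodule.sum_mem _ fun p hp => ?_
    have hp' : p.degree ≠ n := by
      simp at hp
      exact hp.2
    rw [← mul_one ((x.filter (fun p => ¬ p.degree = n)) p), ← smul_eq_mul,
      ← Finsupp.smul_single, map_smul]
    refine Submodule.smul_mem _ _ ?_
    have h1 := G.expand_symm_word p
    rw [word] at h1
    rw [h1]
    exact Submodule.mem_iSup_of_mem p.degree (Submodule.mem_iSup_of_mem hp' (G.eval_mem p))
  have h0 := Submodule.disjoint_def.mp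
    ((DGCategory.isInternal (k := k) X Y).submodule_iSupIndep n) _ e2 e3
  have h0' : x.filter (fun p => ¬ p.degree = n) = 0 := by simpa using h0
  rw [h0', add_zero] at hx
  rwa [← hx]

theorem expand_d {X Y : C} (f : X ⟶ Y) : G.expand X Y (DGCategory.d (k := k) X Y f) =
    leibnizExt (fun {U V} e => G.expand U V (DGCategory.d (k := k) U V (G.val e))) X Y
      (G.expand X Y f) := by
  obtain ⟨x, rfl⟩ := (G.expand X Y).symm.surjective f
  rw [LinearEquiv.apply_symm_apply]
  refine lin_ext_apply (f := (G.expand X Y).toLinearMap.comp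
    ((DGCategory.d (k := k) X Y).comp (G.expand X Y).symm.toLinearMap)) (fun p => ?_) x
  simp only [LinearMap.comp_apply, LinearEquiv.coe_coe, expand_symm_word, leibnizExt_word]
  induction p with
  | nil =>
    have h : DGCategory.d (k := k) X X (𝟙 X) = 0 := (id_mem_cocycles k _).2
    simp [Word.eval, leibnizWord, h]
  | cons p e ih =>
    have h2 : G.expand _ _ (G.val e) = word k (Word.single e) := by
      rw [← expand_eval]; simp [Word.eval, Word.single]
    have ih' := ih (word k p)
    rw [leibnizWord, Word.eval, DGCategory.leibniz _ (G.val_mem e), Units.smul_def, map_add,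
      map_zsmul, expand_comp, expand_comp, ih', expand_eval, h2, Units.smul_def]

/-- The generators of `C` with their degrees and differentials. -/
noncomputable abbrev toDGQuiver : DGQuiver.{w} k C where
  toGradedQuiver := G.toGradedQuiver
  dGen {X Y} e := G.expand X Y (DGCategory.d (k := k) X Y (G.val e))
  dGen_mem e := G.expand_mem (DGCategory.d_mem (G.val_mem e))
  d_dGen e := by rw [← expand_d, DGCategory.d_d, map_zero]

end SemifreeGenerators

/-! ### The cylinder -/

/-- The generating morphisms of the cylinder.  Its objects are `(X, false) = i₁ X` and
`(X, true) = i₂ X`, for all objects `X`. -/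
inductive CylGen {O : Type u} (Q : GradedQuiver.{w} O) : O × Bool → O × Bool → Type (max u w)
  /-- The two copies `i₁ f` (for `r = false`) and `i₂ f` (for `r = true`) of a generator `f`. -/
  | copy (r : Bool) {X Y : O} (f : Q.Gen X Y) : CylGen Q (X, r) (Y, r)
  | t (X : O) : CylGen Q (X, false) (X, true)
  | t' (X : O) : CylGen Q (X, true) (X, false)
  | tHat (X : O) : CylGen Q (X, false) (X, false)
  | tCheck (X : O) : CylGen Q (X, true) (X, true)
  | tBar (X : O) : CylGen Q (X, false) (X, true)
  /-- The morphism `t_f` for a generator `f`. -/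
  | tGen {X Y : O} (f : Q.Gen X Y) : CylGen Q (X, false) (Y, true)

/-- The degree of a generating morphism of the cylinder. -/
def CylGen.deg {O : Type u} {Q : GradedQuiver.{w} O} : ∀ {X Y : O × Bool}, CylGen Q X Y → ℤ
  | _, _, .copy _ f => Q.deg f
  | _, _, .t _ => 0
  | _, _, .t' _ => 0
  | _, _, .tHat _ => -1
  | _, _, .tCheck _ => -1
  | _, _, .tBar _ => -2
  | _, _, .tGen f => Q.deg f - 1

namespace GradedQuiver

variable {k : Type*} [CommRing k] {O : Type u} (Q : GradedQuiver.{w} O)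

/-- The graded quiver of generating morphisms of the cylinder. -/
abbrev cyl : GradedQuiver.{max u w} (O × Bool) where
  Gen := CylGen Q
  deg := CylGen.deg

variable {Q}

/-- A generating morphism of the cylinder as a morphism. -/
noncomputable def letter {X Y : O × Bool} (e : CylGen Q X Y) : Q.cyl.Lin k X Y :=
  word k (Word.single (Q := Q.cyl) e)

/-- The copies `i₁ p` and `i₂ p` of a word `p`. -/
def copyWord (r : Bool) {X : O} : ∀ {Y : O}, Q.Word X Y → Q.cyl.Word (X, r) (Y, r)
  | _, .nil => .nil
  | _, .cons p e => .cons (Q := Q.cyl) (copyWord r p) (CylGen.copy r e)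

/-- The linear extension of `copyWord`. -/
noncomputable def copyLin (r : Bool) (X Y : O) : Q.Lin k X Y →ₗ[k] Q.cyl.Lin k (X, r) (Y, r) :=
  Finsupp.lmapDomain k k (copyWord r)

/-- The morphism `t_p` for a word `p = f_n ∘ ⋯ ∘ f_1`, namely
`∑ j, (-1)^(|f_{j-1}| + ⋯ + |f_1|) i₂ (f_n ∘ ⋯ ∘ f_{j+1}) ∘ t_{f_j} ∘ i₁ (f_{j-1} ∘ ⋯ ∘ f_1)`,
in the recursive form `t_{e ∘ p} = i₂ e ∘ t_p + (-1)^|p| t_e ∘ i₁ p`. -/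
noncomputable def tWord {X : O} : ∀ {Y : O}, Q.Word X Y → Q.cyl.Lin k (X, false) (Y, true)
  | _, .nil => 0
  | _, .cons p e => mul (tWord p) (letter (.copy true e)) +
      p.degree.negOnePow • mul (word k (copyWord false p)) (letter (.tGen e))

/-- The morphism `t_θ` for a linear combination `θ` of words. -/
noncomputable def tLin (X Y : O) : Q.Lin k X Y →ₗ[k] Q.cyl.Lin k (X, false) (Y, true) :=
  Finsupp.linearCombination k tWord

@[simp] theorem copyLin_word (r : Bool) {X Y : O} (p : Q.Word X Y) :
    copyLin r X Y (word k p) = word k (copyWord r p) := by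
  simp [copyLin, word]

@[simp] theorem tLin_word {X Y : O} (p : Q.Word X Y) : tLin X Y (word k p) = tWord p := by
  simp [tLin, word]

theorem copyWord_degree (r : Bool) {X Y : O} (p : Q.Word X Y) :
    (copyWord r p).degree = p.degree := by
  induction p with
  | nil => rfl
  | cons p e ih => rw [copyWord, Word.degree, Word.degree, ih]; rfl

theorem copyWord_comp (r : Bool) {X Y Z : O} (p : Q.Word X Y) (q : Q.Word Y Z) :
    copyWord r (p.comp q) = (copyWord r p).comp (copyWord r q) := by
  induction q with
  | nil => rfl
  | cons q e ih => rw [Word.comp_cons, copyWord, ih]; rfl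

theorem copyLin_mem (r : Bool) {X Y : O} {n : ℤ} {x : Q.Lin k X Y} (hx : x ∈ Q.homog k X Y n) :
    copyLin r X Y x ∈ Q.cyl.homog k (X, r) (Y, r) n := by
  refine homog_le (fun p hp => ?_) hx
  rw [copyLin_word, ← hp, ← copyWord_degree r p]
  exact word_mem _

theorem copyLin_mul (r : Bool) {X Y Z : O} (x : Q.Lin k X Y) (y : Q.Lin k Y Z) :
    copyLin r X Z (mul x y) = mul (copyLin r X Y x) (copyLin r Y Z y) := by
  refine lin_ext_apply (f := (copyLin r X Z).comp (mul.flip y))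
    (g := (mul.flip (copyLin r Y Z y)).comp (copyLin r X Y)) (fun p => ?_) x
  refine lin_ext_apply (f := (copyLin r X Z).comp (mul (word k p)))
    (g := (mul (copyLin r X Y (word k p))).comp (copyLin r Y Z)) (fun q => ?_) y
  simp [copyWord_comp]

theorem letter_mem {X Y : O × Bool} (e : CylGen Q X Y) :
    letter (k := k) e ∈ Q.cyl.homog k X Y e.deg :=
  word_single_mem (Q := Q.cyl) e

theorem tLin_mem {X Y : O} {n : ℤ} {x : Q.Lin k X Y} (hx : x ∈ Q.homog k X Y n) :
    tLin X Y x ∈ Q.cyl.homog k (X, false) (Y, true) (n - 1) := by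
  refine homog_le (fun p hp => ?_) hx
  subst hp
  rw [tLin_word]
  induction p with
  | nil => simp [tWord]
  | cons p e ih =>
    rw [tWord, Units.smul_def]
    refine Submodule.add_mem _ ?_ (zsmul_mem ?_ _)
    · have := mul_mem (ih (word_mem p)) (letter_mem (k := k) (.copy true e))
      convert this using 2
      simp only [CylGen.deg, Word.degree]; abel
    · have := mul_mem (word_mem (k := k) (copyWord false p)) (letter_mem (k := k) (.tGen e))
      convert this using 2
      simp only [CylGen.deg, Word.degree, copyWord_degree]; abel

theorem letter_copy (r : Bool) {X Y : O} (e : Q.Gen X Y) :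
    letter (.copy r e) = copyLin r X Y (word k (.single e)) := by
  rw [copyLin_word]; rfl

theorem tWord_comp {X Y Z : O} (p : Q.Word X Y) (q : Q.Word Y Z) :
    tWord (k := k) (p.comp q) = mul (tWord p) (word k (copyWord true q)) +
      p.degree.negOnePow • mul (word k (copyWord false p)) (tWord q) := by
  induction q with
  | nil => simp [tWord, copyWord]
  | cons q e ih =>
    rw [Word.comp_cons, tWord, ih, tWord, copyWord_comp, copyWord, word_cons (Q := Q.cyl),
      ← mul_word (copyWord false p)]
    change _ = mul _ (mul _ (letter (.copy true e))) + _
    simp only [Word.degree_comp, Int.negOnePow_add, Units.smul_def, map_add, map_zsmul,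
      LinearMap.add_apply, LinearMap.smul_apply, GradedQuiver.mul_assoc, mul_smul,
      smul_add]
    abel

theorem tLin_mul {X Y Z : O} {n : ℤ} {x : Q.Lin k X Y} (hx : x ∈ Q.homog k X Y n)
    (y : Q.Lin k Y Z) : tLin X Z (mul x y) = mul (tLin X Y x) (copyLin true Y Z y) +
      n.negOnePow • mul (copyLin false X Y x) (tLin Y Z y) := by
  refine homog_ext (f := (tLin X Z).comp (mul.flip y))
    (g := (mul.flip (copyLin true Y Z y)).comp (tLin X Y) +
      (n.negOnePow : ℤ) • (mul.flip (tLin Y Z y)).comp (copyLin false X Y)) (fun p hp => ?_) hx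
  subst hp
  refine lin_ext_apply (f := (tLin X Z).comp (mul (word k p)))
    (g := (mul (tLin X Y (word k p))).comp (copyLin true Y Z) +
      (p.degree.negOnePow : ℤ) • (mul (copyLin false X Y (word k p))).comp (tLin Y Z))
    (fun q => ?_) y
  simp [tWord_comp, Units.smul_def]

end GradedQuiver

namespace DGQuiver

variable {k : Type*} [CommRing k] {O : Type u} (D : DGQuiver.{w} k O)

/-- The differential of the generating morphisms of the cylinder:
`d t = d t' = 0`, `d t̂ = 1 - t' ∘ t`, `d ť = 1 - t ∘ t'`, `d t̄ = t ∘ t̂ - ť ∘ t`,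
`d (i_r f) = i_r (d f)` and `d t_f = (-1)^|f| (i₂ f ∘ t - t ∘ i₁ f) + t_{d f}`. -/
noncomputable def cylDGen : ∀ {X Y : O × Bool}, CylGen D.toGradedQuiver X Y →
    D.toGradedQuiver.cyl.Lin k X Y
  | _, _, .copy r f => copyLin r _ _ (D.dGen f)
  | _, _, .t _ => 0
  | _, _, .t' _ => 0
  | _, _, .tHat X => word k .nil - mul (letter (.t X)) (letter (.t' X))
  | _, _, .tCheck X => word k .nil - mul (letter (.t' X)) (letter (.t X))
  | _, _, .tBar X => mul (letter (.tHat X)) (letter (.t X)) -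
      mul (letter (.t X)) (letter (.tCheck X))
  | _, _, @CylGen.tGen _ _ X Y f => (D.deg f).negOnePow •
      (mul (letter (.t X)) (letter (.copy true f)) -
        mul (letter (.copy false f)) (letter (.t Y))) + tLin X Y (D.dGen f)

theorem diff_letter {X Y : O × Bool} (e : CylGen D.toGradedQuiver X Y) :
    leibnizExt (Q := D.toGradedQuiver.cyl) D.cylDGen X Y (letter e) = D.cylDGen e := by
  rw [letter, leibnizExt_word]
  exact leibnizWord_single (Q := D.toGradedQuiver.cyl) D.cylDGen e

theorem diff_mul_letter {X Y Z : O × Bool} (x : D.toGradedQuiver.cyl.Lin k X Y)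
    (e : CylGen D.toGradedQuiver Y Z) :
    leibnizExt (Q := D.toGradedQuiver.cyl) D.cylDGen X Z (mul x (letter e)) =
      mul x (D.cylDGen e) + e.deg.negOnePow •
        mul (leibnizExt (Q := D.toGradedQuiver.cyl) D.cylDGen X Y x) (letter e) := by
  rw [leibnizExt_mul _ _ (letter_mem e), diff_letter]

theorem diff_copyLin (r : Bool) {X Y : O} (x : D.Lin k X Y) :
    leibnizExt (Q := D.toGradedQuiver.cyl) D.cylDGen (X, r) (Y, r) (copyLin r X Y x) =
      copyLin r X Y (D.diff X Y x) := by
  refine lin_ext_apply (f := (leibnizExt (Q := D.toGradedQuiver.cyl) D.cylDGen (X, r) (Y, r)).comp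
    (copyLin r X Y)) (g := (copyLin r X Y).comp (D.diff X Y)) (fun p => ?_) x
  simp only [LinearMap.comp_apply, copyLin_word, leibnizExt_word]
  induction p with
  | nil => simp [copyWord, leibnizWord]
  | cons p e ih =>
    have ih' := ih (word k p)
    rw [copyWord, leibnizWord, leibnizWord, ih']
    simp only [map_add, copyLin_mul, copyLin_word, Units.smul_def, map_zsmul]
    rfl

theorem diff_tLin {X Y : O} {n : ℤ} {x : D.Lin k X Y} (hx : x ∈ D.homog k X Y n) :
    leibnizExt (Q := D.toGradedQuiver.cyl) D.cylDGen (X, false) (Y, true) (tLin X Y x) =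
      n.negOnePow • (mul (letter (.t X)) (copyLin true X Y x) -
        mul (copyLin false X Y x) (letter (.t Y))) + tLin X Y (D.diff X Y x) := by
  refine homog_ext
    (f := (leibnizExt (Q := D.toGradedQuiver.cyl) D.cylDGen (X, false) (Y, true)).comp (tLin X Y))
    (g := (n.negOnePow : ℤ) • ((mul (letter (.t X))).comp (copyLin true X Y) -
      (mul.flip (letter (.t Y))).comp (copyLin false X Y)) + (tLin X Y).comp (D.diff X Y))
    (fun p hp => ?_) hx
  subst hp
  simp only [LinearMap.comp_apply, LinearMap.add_apply, LinearMap.sub_apply, LinearMap.smul_apply,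
    LinearMap.flip_apply, copyLin_word, tLin_word, leibnizExt_word]
  clear hx x
  induction p with
  | nil => simp [tWord, leibnizWord, copyWord]
  | cons p e ih =>
    have hd : leibnizExt (Q := D.toGradedQuiver.cyl) D.cylDGen _ _ (word k (copyWord false p)) =
        copyLin false _ _ (leibnizWord D.dGen p) := by
      rw [← copyLin_word, diff_copyLin, leibnizExt_word]
    have h1 := tLin_mul (word_mem (k := k) p) (D.dGen e)
    have h2 := tLin_mul (leibnizExt_mem D.dGen D.dGen_mem (word_mem (k := k) p))
      (word k (Word.single e))
    rw [leibnizExt_word] at h2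
    have ht : tLin _ _ (word k (Word.single e)) = letter (k := k) (.tGen e) := by
      simp [tLin_word, Word.single, tWord, Word.degree, copyWord]
    rw [ht, ← letter_copy] at h2
    rw [tWord, map_add, diff_mul_letter, Units.smul_def p.degree.negOnePow, map_zsmul,
      diff_mul_letter, ih, hd,
      leibnizWord, map_add (tLin _ _), h1, Units.smul_def (D.deg e).negOnePow, map_zsmul, h2]
    have hc : ∀ r, word k (copyWord r (p.cons e)) =
        mul (word k (copyWord r p)) (letter (.copy r e)) := fun r => by
      rw [copyWord, word_cons (Q := D.toGradedQuiver.cyl)]; rfl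
    rw [hc, hc]
    simp only [cylDGen, CylGen.deg, Word.degree, tLin_word, copyLin_word, Units.smul_def, map_add,
      map_sub, map_zsmul, LinearMap.add_apply, LinearMap.sub_apply, LinearMap.smul_apply,
      GradedQuiver.mul_assoc, Int.negOnePow_add, Int.negOnePow_sub]
    rcases Int.units_eq_one_or p.degree.negOnePow with h | h <;>
    rcases Int.units_eq_one_or (D.deg e).negOnePow with h' | h' <;>
    simp [h, h'] <;> abel

theorem cylDGen_mem {X Y : O × Bool} (e : CylGen D.toGradedQuiver X Y) :
    D.cylDGen e ∈ D.toGradedQuiver.cyl.homog k X Y (e.deg + 1) := by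
  have hl {X Y : O × Bool} {n : ℤ} (e : CylGen D.toGradedQuiver X Y) (h : e.deg = n) :
      letter (k := k) e ∈ D.toGradedQuiver.cyl.homog k X Y n := h ▸ letter_mem e
  have h1 (Z : O × Bool) : word k (Word.nil : D.toGradedQuiver.cyl.Word Z Z) ∈
      D.toGradedQuiver.cyl.homog k Z Z 0 := word_mem _
  cases e with
  | copy r f => exact copyLin_mem r (D.dGen_mem f)
  | t X => exact zero_mem _
  | t' X => exact zero_mem _
  | tHat X =>
    have h := mul_mem (hl (.t X) (n := 0) rfl) (hl (.t' X) (n := 0) rfl)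
    exact sub_mem (h1 _) h
  | tCheck X =>
    have h := mul_mem (hl (.t' X) (n := 0) rfl) (hl (.t X) (n := 0) rfl)
    exact sub_mem (h1 _) h
  | tBar X =>
    have h := mul_mem (hl (.tHat X) (n := -1) rfl) (hl (.t X) (n := 0) rfl)
    have h' := mul_mem (hl (.t X) (n := 0) rfl) (hl (.tCheck X) (n := -1) rfl)
    exact sub_mem h h'
  | @tGen X Y f =>
    have h1 := mul_mem (hl (.t X) rfl) (hl (.copy true f) rfl)
    have h2 := mul_mem (hl (.copy false f) rfl) (hl (.t Y) rfl)
    have h3 := tLin_mem (D.dGen_mem f)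
    simp only [CylGen.deg, zero_add, add_zero, add_sub_cancel_right] at h1 h2 h3
    simp only [cylDGen, CylGen.deg, sub_add_cancel, Units.smul_def]
    exact add_mem (zsmul_mem (sub_mem h1 h2) _) h3

theorem diff_nil (X : O × Bool) :
    leibnizExt (Q := D.toGradedQuiver.cyl) D.cylDGen X X (word k .nil) = 0 := by
  rw [leibnizExt_word, leibnizWord]

theorem diff_cylDGen {X Y : O × Bool} (e : CylGen D.toGradedQuiver X Y) :
    leibnizExt (Q := D.toGradedQuiver.cyl) D.cylDGen X Y (D.cylDGen e) = 0 := by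
  cases e with
  | copy r f =>
    have h := D.d_dGen f
    rw [cylDGen, diff_copyLin, h, map_zero]
  | t X => exact map_zero _
  | t' X => exact map_zero _
  | tHat X =>
    rw [cylDGen, map_sub, diff_mul_letter, diff_letter, diff_nil]
    simp only [cylDGen, map_zero, LinearMap.zero_apply, smul_zero, add_zero, sub_zero]
  | tCheck X =>
    rw [cylDGen, map_sub, diff_mul_letter, diff_letter, diff_nil]
    simp only [cylDGen, map_zero, LinearMap.zero_apply, smul_zero, add_zero, sub_zero]
  | tBar X =>
    rw [cylDGen, map_sub, diff_mul_letter, diff_mul_letter, diff_letter, diff_letter]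
    simp only [cylDGen, CylGen.deg, map_zero, map_sub, LinearMap.zero_apply, LinearMap.sub_apply,
      smul_zero, add_zero, zero_add, Int.negOnePow_zero, one_smul, GradedQuiver.mul_one,
      GradedQuiver.one_mul, GradedQuiver.mul_assoc, sub_self]
  | @tGen X Y f =>
    have h := D.d_dGen f
    rw [cylDGen, map_add, Units.smul_def, map_zsmul, map_sub, diff_mul_letter, diff_mul_letter,
      diff_letter, diff_letter, diff_tLin _ (D.dGen_mem f), h]
    simp only [cylDGen, CylGen.deg, map_zero, LinearMap.zero_apply, smul_zero, add_zero,
      zero_add, Int.negOnePow_zero, one_smul, Int.negOnePow_succ]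
    rcases Int.units_eq_one_or (D.deg f).negOnePow with h' | h' <;> simp [h']

/-- The generating morphisms and the differential of the cylinder of a semifree dg category. -/
noncomputable def cylinder : DGQuiver.{max u w} k (O × Bool) where
  toGradedQuiver := D.toGradedQuiver.cyl
  dGen := D.cylDGen
  dGen_mem := D.cylDGen_mem
  d_dGen := D.diff_cylDGen

end DGQuiver

namespace SemifreeGenerators

variable {k : Type*} [CommRing k] {C : Type u} [Category.{v} C] [Preadditive C] [Linear k C]
  [DGCategory k C] (G : SemifreeGenerators.{w} k C)

/-- The cylinder `Cyl (C)` of a semifree dg category `C` with a chosen set of generating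
morphisms. -/
abbrev Cyl : Type u := FreeDG G.toDGQuiver.cylinder

/-- The two inclusions of `C` into the cylinder: `i₁` for `r = false` and `i₂` for `r = true`. -/
noncomputable def incl (r : Bool) : DGFunctor k C G.Cyl where
  obj X := ⟨(X, r)⟩
  map {X Y} f := copyLin r X Y (G.expand X Y f)
  map_id X := (congrArg (copyLin r X X) (G.expand_id X)).trans (copyLin_word r .nil)
  map_comp f g := (congrArg (copyLin r _ _) (G.expand_comp f g)).trans (copyLin_mul r _ _)
  map_add f g := map_add ((copyLin r _ _).comp (G.expand _ _).toLinearMap) f g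
  map_smul a f := map_smul ((copyLin r _ _).comp (G.expand _ _).toLinearMap) a f
  map_mem h := copyLin_mem r (G.expand_mem h)
  map_d f := by
    rw [expand_d]
    exact (G.toDGQuiver.diff_copyLin r _).symm

/-- The inclusion `i₁ : C ⟶ Cyl (C)`. -/
noncomputable abbrev i₁ : DGFunctor k C G.Cyl := G.incl false

/-- The inclusion `i₂ : C ⟶ Cyl (C)`. -/
noncomputable abbrev i₂ : DGFunctor k C G.Cyl := G.incl true

end SemifreeGenerators

/-! ### Homotopies -/

namespace DGFunctor

variable {k : Type*} [CommRing k]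
  {A : Type*} [Category* A] [Preadditive A] [Linear k A] [DGCategory k A]
  {B : Type*} [Category* B] [Preadditive B] [Linear k B] [DGCategory k B]

/-- Two dg functors `F₁ F₂ : A ⟶ B` on a semifree dg category are homotopic with respect to the
cylinder `Cyl (A)`. -/
def Homotopic (GA : SemifreeGenerators k A) (F₁ F₂ : DGFunctor k A B) : Prop :=
  ∃ H : DGFunctor k GA.Cyl B, GA.i₁.comp H = F₁ ∧ GA.i₂.comp H = F₂

/-- A dg functor between semifree dg categories is a homotopy equivalence with respect to the
cylinder. -/
def IsHomotopyEquivalence (GA : SemifreeGenerators k A) (GB : SemifreeGenerators k B)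
    (F : DGFunctor k A B) : Prop :=
  ∃ G : DGFunctor k B A, Homotopic GA (F.comp G) (DGFunctor.id k A) ∧
    Homotopic GB (G.comp F) (DGFunctor.id k B)

end DGFunctor

end DG

/-! A functor on the cylinder amounts to explicit data (`DGFunctor.homotopic_iff`): closed degree-0
morphisms t_X, each with a coherent homotopy inverse, and a map T of degree -1 on all morphisms, a
signed derivation from F₁ to F₂ whose differential measures the failure of t to be natural. The
theorem is proved for such `Homotopy` structures.

If G is a homotopy inverse of F, then T makes t natural up to coboundaries on cocycles, while each
t_X is invertible in H^0. Hence a dg endofunctor homotopic to the identity is bijective on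
cohomology. Applied to both composites of F and G this gives bijectivity for F, and the components
of the homotopy FG ≈ 1 give essential surjectivity.

The converse is obstruction theory: semifree dg categories behave like cofibrant objects. By
`AcyclicExtension.exists_section`, an extension with a relative lifting property has a section over
a semifree dg category. The value at a generator is chosen by recursion along the well-order: its
differential is prescribed by smaller generators and is closed, and acyclicity solves the equation.

For a quasi-equivalence F, choose objects oX and homotopy equivalences t_X : F(oX) → X. A functor G
with object map o, together with a homotopy FG ≈ 1 with components t, is a section of
`inverseExtension`; the lifting property is acyclicity of the cone of `F` followed by composition
with t_Y (`exists_primitive_comp`). Precomposing with F gives FGF ≈ F, and this homotopy lifts along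
F to GF ≈ 1, by a second section problem (`homotopyExtension`). -/

namespace DG

/-! ### Cocycles, coboundaries and coherent homotopy inverses -/

section Calculus

variable {k : Type*} [CommRing k] {C : Type*} [Category* C] [Preadditive C] [Linear k C]
  [DGCategory k C] {X Y Z : C}

/-- Two linear maps that agree on homogeneous morphisms are equal. -/
theorem DGCategory.linear_ext {M : Type*} [AddCommGroup M] [Module k M]
    {φ ψ : (X ⟶ Y) →ₗ[k] M}
    (h : ∀ (n : ℤ), ∀ f ∈ DGCategory.grading (k := k) X Y n, φ f = ψ f) : φ = ψ := by
  have h1 : (⨆ n, DGCategory.grading (k := k) X Y n) ≤ LinearMap.eqLocus φ ψ :=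
    iSup_le fun n f hf => h n f hf
  rw [(DGCategory.isInternal (k := k) X Y).submodule_iSup_eq_top] at h1
  exact LinearMap.ext fun f => h1 trivial

theorem coeLinearMap_grading_bijective (X Y : C) :
    Function.Bijective (DirectSum.coeLinearMap (DGCategory.grading (k := k) X Y)) :=
  DGCategory.isInternal X Y

theorem mem_cocycles_iff {n : ℤ} {f : X ⟶ Y} : f ∈ cocycles k X Y n ↔
    f ∈ DGCategory.grading (k := k) X Y n ∧ DGCategory.d (k := k) X Y f = 0 := Iff.rfl

variable (k) in
/-- The sign involution, multiplying morphisms of degree `n` by `(-1)^n`. -/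
noncomputable def signInvolution (X Y : C) : (X ⟶ Y) →ₗ[k] (X ⟶ Y) :=
  (DirectSum.toModule k ℤ (X ⟶ Y) fun n : ℤ =>
    (n.negOnePow : ℤ) • (DGCategory.grading (k := k) X Y n).subtype).comp
  (LinearEquiv.ofBijective (DirectSum.coeLinearMap (DGCategory.grading (k := k) X Y))
    (coeLinearMap_grading_bijective X Y)).symm.toLinearMap

theorem signInvolution_apply {n : ℤ} {f : X ⟶ Y} (hf : f ∈ DGCategory.grading (k := k) X Y n) :
    signInvolution k X Y f = n.negOnePow • f := by
  have h : (LinearEquiv.ofBijective (DirectSum.coeLinearMap (DGCategory.grading (k := k) X Y))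
      (coeLinearMap_grading_bijective X Y)).symm f = DirectSum.lof k ℤ _ n ⟨f, hf⟩ := by
    rw [LinearEquiv.symm_apply_eq, LinearEquiv.ofBijective_apply, DirectSum.coeLinearMap_lof]
  rw [signInvolution, LinearMap.comp_apply, LinearEquiv.coe_coe, h, DirectSum.toModule_lof]
  rfl

theorem d_comp_cocycle (f : X ⟶ Y) {g : Y ⟶ Z} (hg : g ∈ cocycles k Y Z 0) :
    DGCategory.d (k := k) X Z (f ≫ g) = DGCategory.d (k := k) X Y f ≫ g := by
  have h : DGCategory.d (k := k) Y Z g = 0 := hg.2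
  rw [DGCategory.leibniz f hg.1, h]
  simp

theorem d_closed_comp {f : X ⟶ Y} (hf : DGCategory.d (k := k) X Y f = 0) {n : ℤ} {g : Y ⟶ Z}
    (hg : g ∈ DGCategory.grading (k := k) Y Z n) :
    DGCategory.d (k := k) X Z (f ≫ g) = f ≫ DGCategory.d (k := k) Y Z g := by
  rw [DGCategory.leibniz f hg, hf]
  simp

theorem comp_mem' {l m n : ℤ} {f : X ⟶ Y} {g : Y ⟶ Z}
    (hf : f ∈ DGCategory.grading (k := k) X Y m) (hg : g ∈ DGCategory.grading (k := k) Y Z n)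
    (h : m + n = l) : f ≫ g ∈ DGCategory.grading (k := k) X Z l :=
  h ▸ DGCategory.comp_mem hf hg

theorem d_mem' {m n : ℤ} {f : X ⟶ Y} (hf : f ∈ DGCategory.grading (k := k) X Y m)
    (h : m + 1 = n) : DGCategory.d (k := k) X Y f ∈ DGCategory.grading (k := k) X Y n :=
  h ▸ DGCategory.d_mem hf

theorem units_smul_mem {M : Type*} [AddCommGroup M] [Module k M] (N : Submodule k M) (a : ℤˣ)
    {x : M} (h : x ∈ N) : a • x ∈ N := by
  rw [Units.smul_def]; exact zsmul_mem h _

theorem d_units_smul (a : ℤˣ) (f : X ⟶ Y) :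
    DGCategory.d (k := k) X Y (a • f) = a • DGCategory.d (k := k) X Y f := by
  rw [Units.smul_def, Units.smul_def, map_zsmul]

theorem coboundary_comp_cocycle {n : ℤ} {f : X ⟶ Y} {g : Y ⟶ Z} (hf : f ∈ coboundaries k X Y n)
    (hg : g ∈ cocycles k Y Z 0) : f ≫ g ∈ coboundaries k X Z n := by
  obtain ⟨a, ha, rfl⟩ := hf
  exact ⟨a ≫ g, comp_mem' ha hg.1 (add_zero _), d_comp_cocycle a hg⟩

theorem cocycle_comp_coboundary {n : ℤ} {f : X ⟶ Y} {g : Y ⟶ Z} (hf : f ∈ cocycles k X Y 0)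
    (hg : g ∈ coboundaries k Y Z n) : f ≫ g ∈ coboundaries k X Z n := by
  obtain ⟨a, ha, rfl⟩ := hg
  exact ⟨f ≫ a, comp_mem' hf.1 ha (zero_add _), d_closed_comp hf.2 ha⟩

theorem cocycle_comp_coboundary_zero {n : ℤ} {f : X ⟶ Y} {g : Y ⟶ Z} (hf : f ∈ cocycles k X Y n)
    (hg : g ∈ coboundaries k Y Z 0) : f ≫ g ∈ coboundaries k X Z n := by
  obtain ⟨a, ha, rfl⟩ := hg
  exact ⟨f ≫ a, comp_mem' hf.1 ha (by ring), d_closed_comp hf.2 ha⟩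

/-- In diagrammatic order the Leibniz sign is that of the right factor, so the primitive `a ≫ g`
must be corrected by `(-1)^n`. -/
theorem coboundary_zero_comp_cocycle {n : ℤ} {f : X ⟶ Y} {g : Y ⟶ Z}
    (hf : f ∈ coboundaries k X Y 0) (hg : g ∈ cocycles k Y Z n) :
    f ≫ g ∈ coboundaries k X Z n := by
  obtain ⟨a, ha, rfl⟩ := hf
  have h : DGCategory.d (k := k) Y Z g = 0 := hg.2
  refine ⟨n.negOnePow • (a ≫ g), units_smul_mem _ _ (comp_mem' ha hg.1 (by ring)), ?_⟩
  rw [d_units_smul, DGCategory.leibniz a hg.1, h, Limits.comp_zero, zero_add, smul_smul,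
    Int.units_mul_self, one_smul]

theorem comp_mem_cocycles' {l m n : ℤ} {f : X ⟶ Y} {g : Y ⟶ Z} (hf : f ∈ cocycles k X Y m)
    (hg : g ∈ cocycles k Y Z n) (h : m + n = l) : f ≫ g ∈ cocycles k X Z l := by
  refine mem_cocycles_iff.mpr ⟨comp_mem' hf.1 hg.1 h, ?_⟩
  have h1 : DGCategory.d (k := k) Y Z g = 0 := hg.2
  rw [d_closed_comp hf.2 hg.1, h1, Limits.comp_zero]

variable (k) in
/-- A coherent homotopy inverse of a morphism `t`. -/
structure HomotopyInverse (t : X ⟶ Y) where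
  inv : Y ⟶ X
  hat : X ⟶ X
  check : Y ⟶ Y
  bar : X ⟶ Y
  inv_mem : inv ∈ cocycles k Y X 0
  hat_mem : hat ∈ DGCategory.grading (k := k) X X (-1)
  check_mem : check ∈ DGCategory.grading (k := k) Y Y (-1)
  bar_mem : bar ∈ DGCategory.grading (k := k) X Y (-2)
  d_hat : DGCategory.d (k := k) X X hat = 𝟙 X - t ≫ inv
  d_check : DGCategory.d (k := k) Y Y check = 𝟙 Y - inv ≫ t
  d_bar : DGCategory.d (k := k) X Y bar = hat ≫ t - t ≫ check

/-- Every homotopy inverse can be made coherent. -/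
theorem nonempty_homotopyInverse {t : X ⟶ Y} {t' : Y ⟶ X} (ht : t ∈ cocycles k X Y 0)
    (ht' : t' ∈ cocycles k Y X 0) (h₁ : 𝟙 X - t ≫ t' ∈ coboundaries k X X 0)
    (h₂ : 𝟙 Y - t' ≫ t ∈ coboundaries k Y Y 0) : Nonempty (HomotopyInverse k t) := by
  obtain ⟨h, hh, dh⟩ := h₁
  obtain ⟨c, hc, dc⟩ := h₂
  rw [zero_sub] at hh hc
  -- The obstruction to coherence is a closed morphism e = h ≫ t - t ≫ c of degree -1.
  have he : h ≫ t - t ≫ c ∈ DGCategory.grading (k := k) X Y (-1) :=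
    sub_mem (comp_mem' hh ht.1 (by ring)) (comp_mem' ht.1 hc (by ring))
  have de : DGCategory.d (k := k) X Y (h ≫ t - t ≫ c) = 0 := by
    rw [map_sub, d_comp_cocycle h ht, d_closed_comp ht.2 hc, dh, dc]
    simp
  -- Adding t' ≫ e to c leaves its differential unchanged and turns the obstruction into (1 - t ≫
  -- t') ≫ e = dh ≫ e, which is d(-(h ≫ e)) because e is closed of odd degree.
  refine ⟨⟨t', h, c + t' ≫ (h ≫ t - t ≫ c), -(h ≫ (h ≫ t - t ≫ c)), ht', hh,
    add_mem hc (comp_mem' ht'.1 he (by ring)), neg_mem (comp_mem' hh he (by ring)), dh, ?_, ?_⟩⟩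
  · rw [map_add, d_closed_comp ht'.2 he, de, dc]
    simp
  · rw [map_neg, DGCategory.leibniz h he, de, dh]
    simp
    abel

end Calculus

/-! ### Maps on cohomology and acyclicity of cones -/

namespace DGFunctor

variable {k : Type*} [CommRing k]
  {C : Type*} [Category* C] [Preadditive C] [Linear k C] [DGCategory k C]
  {D : Type*} [Category* D] [Preadditive D] [Linear k D] [DGCategory k D]
  (F : DGFunctor k C D)

theorem map_sub {X Y : C} (f g : X ⟶ Y) : F.map (f - g) = F.map f - F.map g :=
  _root_.map_sub (F.mapLinear X Y) f g

theorem map_zero {X Y : C} : F.map (0 : X ⟶ Y) = 0 := _root_.map_zero (F.mapLinear X Y)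

theorem map_units_smul {X Y : C} (a : ℤˣ) (f : X ⟶ Y) : F.map (a • f) = a • F.map f := by
  rw [Units.smul_def, Units.smul_def]
  exact map_zsmul (F.mapLinear X Y) _ f

theorem mapCohomology_injective_iff (X Y : C) (n : ℤ) :
    Function.Injective (F.mapCohomology X Y n) ↔
      ∀ z ∈ cocycles k X Y n, F.map z ∈ coboundaries k (F.obj X) (F.obj Y) n →
        z ∈ coboundaries k X Y n := by
  rw [injective_iff_map_eq_zero]
  constructor
  · intro h z hz hF
    have := h (Submodule.Quotient.mk ⟨z, hz⟩) ((Submodule.Quotient.mk_eq_zero _).mpr hF)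
    exact (Submodule.Quotient.mk_eq_zero ((coboundaries k X Y n).submoduleOf _)).mp this
  · intro h a ha
    obtain ⟨⟨z, hz⟩, rfl⟩ := Submodule.Quotient.mk_surjective _ a
    exact (Submodule.Quotient.mk_eq_zero _).mpr (h z hz ((Submodule.Quotient.mk_eq_zero
      ((coboundaries k (F.obj X) (F.obj Y) n).submoduleOf _)).mp ha))

theorem mapCohomology_surjective_iff (X Y : C) (n : ℤ) :
    Function.Surjective (F.mapCohomology X Y n) ↔
      ∀ y ∈ cocycles k (F.obj X) (F.obj Y) n, ∃ x ∈ cocycles k X Y n,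
        F.map x - y ∈ coboundaries k (F.obj X) (F.obj Y) n := by
  constructor
  · intro h y hy
    obtain ⟨a, ha⟩ := h (Submodule.Quotient.mk ⟨y, hy⟩)
    obtain ⟨⟨x, hx⟩, rfl⟩ := Submodule.Quotient.mk_surjective _ a
    exact ⟨x, hx, (Submodule.Quotient.eq
      ((coboundaries k (F.obj X) (F.obj Y) n).submoduleOf _)).mp ha⟩
  · intro h b
    obtain ⟨⟨y, hy⟩, rfl⟩ := Submodule.Quotient.mk_surjective _ b
    obtain ⟨x, hx, hxy⟩ := h y hy
    exact ⟨Submodule.Quotient.mk ⟨x, hx⟩, (Submodule.Quotient.eq _).mpr hxy⟩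

variable {F}

/-- The cone of a quasi-isomorphism is acyclic. -/
theorem exists_primitive {X Y : C} (hF : ∀ n, Function.Bijective (F.mapCohomology X Y n)) {n : ℤ}
    {z : X ⟶ Y} (hz : z ∈ cocycles k X Y (n + 1)) {y : F.obj X ⟶ F.obj Y}
    (hy : y ∈ DGCategory.grading (k := k) (F.obj X) (F.obj Y) n)
    (h : F.map z = DGCategory.d (k := k) _ _ y) :
    ∃ g ∈ DGCategory.grading (k := k) X Y n,
      ∃ s ∈ DGCategory.grading (k := k) (F.obj X) (F.obj Y) (n - 1),
        DGCategory.d (k := k) _ _ g = z ∧ F.map g - y = DGCategory.d (k := k) _ _ s := by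
  -- Injectivity in degree n + 1 gives some primitive of z; its image differs from y by a cocycle.
  obtain ⟨g, hg, rfl⟩ := (F.mapCohomology_injective_iff X Y (n + 1)).mp (hF _).1 z hz
    ⟨y, by rwa [add_sub_cancel_right], h.symm⟩
  rw [add_sub_cancel_right] at hg
  have hw : y - F.map g ∈ cocycles k (F.obj X) (F.obj Y) n :=
    mem_cocycles_iff.mpr ⟨sub_mem hy (F.map_mem hg), by rw [_root_.map_sub, ← h, F.map_d, sub_self]⟩
  -- Surjectivity in degree n represents this difference by F c up to a coboundary, and adding c to
  -- g absorbs it.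
  obtain ⟨c, hc, s, hs, e⟩ := (F.mapCohomology_surjective_iff X Y n).mp (hF _).2 _ hw
  have hc' : DGCategory.d (k := k) X Y c = 0 := hc.2
  refine ⟨g + c, add_mem hg hc.1, s, hs, by rw [_root_.map_add, hc', add_zero], ?_⟩
  rw [e, F.map_add]
  abel

/-- The cone of the composite of a quasi-isomorphism with a homotopy equivalence is acyclic. -/
theorem exists_primitive_comp {X Y : C} (hF : ∀ n, Function.Bijective (F.mapCohomology X Y n))
    {W : D} {t : F.obj Y ⟶ W} (ht : t ∈ cocycles k (F.obj Y) W 0) (I : HomotopyInverse k t) {n : ℤ}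
    {z : X ⟶ Y} (hz : z ∈ cocycles k X Y (n + 1)) {y : F.obj X ⟶ W}
    (hy : y ∈ DGCategory.grading (k := k) (F.obj X) W n)
    (h : F.map z ≫ t = DGCategory.d (k := k) _ _ y) :
    ∃ g ∈ DGCategory.grading (k := k) X Y n,
      ∃ s ∈ DGCategory.grading (k := k) (F.obj X) W (n - 1),
        DGCategory.d (k := k) _ _ g = z ∧ F.map g ≫ t - y = DGCategory.d (k := k) _ _ s := by
  have hFz : F.map z ∈ cocycles k (F.obj X) (F.obj Y) (n + 1) := F.map_mem_cocycles hz
  -- Composing y with the inverse of t gives a primitive of F z ≫ t ≫ inv; the term with `I.hat`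
  -- turns it into a primitive of F z.
  obtain ⟨g, hg, s, hs, e₁, e₂⟩ := exists_primitive hF hz (y := y ≫ I.inv + F.map z ≫ I.hat)
    (add_mem (comp_mem' hy I.inv_mem.1 (add_zero _)) (comp_mem' hFz.1 I.hat_mem (by ring))) (by
      rw [_root_.map_add, d_comp_cocycle y I.inv_mem, d_closed_comp hFz.2 I.hat_mem, ← h, I.d_hat]
      simp)
  -- After composing back with t, `I.check` replaces y ≫ inv ≫ t by y, and the remaining F z ≫ (hat
  -- ≫ t - t ≫ check) is the differential of the `I.bar` term. The coherence of the inverse is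
  -- essential here.
  refine ⟨g, hg, s ≫ t - y ≫ I.check + F.map z ≫ I.bar, ?_, e₁, ?_⟩
  · exact add_mem (sub_mem (comp_mem' hs ht.1 (by ring)) (comp_mem' hy I.check_mem (by ring)))
      (comp_mem' hFz.1 I.bar_mem (by ring))
  · rw [_root_.map_add, _root_.map_sub, d_comp_cocycle s ht, DGCategory.leibniz y I.check_mem,
      d_closed_comp hFz.2 I.bar_mem, ← h, ← e₂, I.d_bar, I.d_check]
    simp
    abel

end DGFunctor

end DG

/-! ### Sections of acyclic extensions over semifree dg categories -/

namespace DG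

open GradedQuiver

namespace GradedQuiver

theorem Word.All.mono {O : Type u} {Q : GradedQuiver.{w} O} {P P' : ∀ {X Y : O}, Q.Gen X Y → Prop}
    (h : ∀ {X Y : O} (e : Q.Gen X Y), P e → P' e) {X Y : O} {p : Q.Word X Y} (hp : p.All P) :
    p.All P' := by
  induction p with
  | nil => trivial
  | cons p e ih => exact ⟨ih hp.1, h e hp.2⟩

/-- Two linear maps that agree on a set of words agree on combinations of these words. -/
theorem eqOn_supported {k : Type*} [CommRing k] {O : Type u} {Q : GradedQuiver.{w} O}
    {N : Type*} [AddCommGroup N] [Module k N] {X Y : O} {S : Set (Q.Word X Y)}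
    {f g : Q.Lin k X Y →ₗ[k] N} (h : ∀ p ∈ S, f (word k p) = g (word k p)) {x : Q.Lin k X Y}
    (hx : x ∈ Finsupp.supported k k S) : f x = g x := by
  rw [Finsupp.supported_eq_span_single] at hx
  refine LinearMap.eqOn_span (R := k) ?_ hx
  rintro _ ⟨p, hp, rfl⟩
  exact h p hp

theorem map_supported_le {k : Type*} [CommRing k] {O : Type u} {Q : GradedQuiver.{w} O}
    {N : Type*} [AddCommGroup N] [Module k N] {X Y : O} {S : Set (Q.Word X Y)}
    {f : Q.Lin k X Y →ₗ[k] N} {T : Submodule k N}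
    (h : ∀ p ∈ S, f (word k p) ∈ T) {x : Q.Lin k X Y} (hx : x ∈ Finsupp.supported k k S) :
    f x ∈ T := by
  rw [Finsupp.supported_eq_span_single] at hx
  refine (Submodule.span_le (p := T.comap f)).mpr ?_ hx
  rintro _ ⟨p, hp, rfl⟩
  exact h p hp

end GradedQuiver

/-- A graded extension of a dg category `A`: a family of modules over the morphism modules of `A`
with units, products and differentials as in a dg category, where the product with an element on
the left, and the differential, may depend on the degree of that element.  The last field says that
the projection to `A` is surjective with acyclic kernel. -/
structure AcyclicExtension (k : Type*) [CommRing k] (A : Type u) [Category.{v} A] [Preadditive A]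
    [Linear k A] [DGCategory k A] where
  M : A → A → Type w
  [addCommGroup : ∀ X Y, AddCommGroup (M X Y)]
  [module : ∀ X Y, Module k (M X Y)]
  grading : ∀ X Y, ℤ → Submodule k (M X Y)
  one : ∀ X, M X X
  mul : ∀ {X Y Z : A}, ℤ → M X Y →ₗ[k] M Y Z →ₗ[k] M X Z
  d : ∀ {X Y : A}, ℤ → M X Y →ₗ[k] M X Y
  π : ∀ {X Y : A}, M X Y →ₗ[k] (X ⟶ Y)
  one_mem : ∀ X, one X ∈ grading X X 0
  mul_mem : ∀ {X Y Z : A} {m n : ℤ} {x : M X Y} {y : M Y Z}, x ∈ grading X Y m →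
    y ∈ grading Y Z n → mul m x y ∈ grading X Z (m + n)
  mul_one : ∀ {X Y : A} (m : ℤ) (x : M X Y), mul m x (one Y) = x
  one_mul : ∀ {X Y : A} (x : M X Y), mul 0 (one X) x = x
  mul_assoc : ∀ {X Y Z W : A} (m n : ℤ) (x : M X Y) (y : M Y Z) (z : M Z W),
    mul (m + n) (mul m x y) z = mul m x (mul n y z)
  d_one : ∀ X, d 0 (one X) = 0
  leibniz : ∀ {X Y Z : A} {m n : ℤ} {x : M X Y} {y : M Y Z}, x ∈ grading X Y m →
    y ∈ grading Y Z n →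
      d (m + n) (mul m x y) = mul m x (d n y) + n.negOnePow • mul (m + 1) (d m x) y
  π_one : ∀ X, π (one X) = 𝟙 X
  π_mul : ∀ {X Y Z : A} (m : ℤ) (x : M X Y) (y : M Y Z), π (mul m x y) = π x ≫ π y
  exists_lift : ∀ {X Y : A} {n : ℤ} {f : X ⟶ Y} {z : M X Y},
    f ∈ DGCategory.grading (k := k) X Y n → z ∈ grading X Y (n + 1) → d (n + 1) z = 0 →
      π z = DGCategory.d (k := k) X Y f → ∃ x ∈ grading X Y n, π x = f ∧ d n x = z

namespace AcyclicExtension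

attribute [instance] addCommGroup module

variable {k : Type*} [CommRing k] {A : Type u} [Category.{v} A] [Preadditive A] [Linear k A]
  [DGCategory k A] (E : AcyclicExtension k A)

section Eval

variable {Q : GradedQuiver A} (σ τ : ∀ e : Σ X Y, Q.Gen X Y, E.M e.1 e.2.1)

/-- The product of the values of the letters of a word. -/
def evalWord {X : A} : ∀ {Y : A}, Q.Word X Y → E.M X Y
  | _, .nil => E.one X
  | _, .cons (Y := Y) (Z := Z) p e => E.mul p.degree (evalWord p) (σ ⟨Y, Z, e⟩)

/-- The linear extension of `evalWord`. -/
noncomputable def evalLin (X Y : A) : Q.Lin k X Y →ₗ[k] E.M X Y :=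
  Finsupp.linearCombination k (E.evalWord σ)

@[simp] theorem evalLin_word {X Y : A} (p : Q.Word X Y) :
    E.evalLin σ X Y (word k p) = E.evalWord σ p := by
  simp [evalLin, word]

theorem evalWord_comp {X Y Z : A} (p : Q.Word X Y) (q : Q.Word Y Z) :
    E.evalWord σ (p.comp q) = E.mul p.degree (E.evalWord σ p) (E.evalWord σ q) := by
  induction q with
  | nil => exact (E.mul_one _ _).symm
  | cons q e ih => rw [Word.comp_cons, evalWord, ih, Word.degree_comp, mul_assoc, evalWord]

theorem evalLin_mul {X Y Z : A} {n : ℤ} {x : Q.Lin k X Y} (hx : x ∈ Q.homog k X Y n)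
    (y : Q.Lin k Y Z) :
    E.evalLin σ X Z (GradedQuiver.mul x y) = E.mul n (E.evalLin σ X Y x) (E.evalLin σ Y Z y) := by
  refine homog_ext (f := (E.evalLin σ X Z).comp (GradedQuiver.mul.flip y))
    (g := ((E.mul n).flip (E.evalLin σ Y Z y)).comp (E.evalLin σ X Y)) (fun p hp => ?_) hx
  subst hp
  refine lin_ext_apply (f := (E.evalLin σ X Z).comp (GradedQuiver.mul (word k p)))
    (g := (E.mul p.degree (E.evalLin σ X Y (word k p))).comp (E.evalLin σ Y Z)) (fun q => ?_) y
  simp [evalWord_comp]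

-- Allows the truncated values available during the recursion to be replaced by the final ones.
variable {σ τ} in
theorem evalWord_congr {P : ∀ {X Y : A}, Q.Gen X Y → Prop}
    (h : ∀ {X Y : A} (e : Q.Gen X Y), P e → σ ⟨X, Y, e⟩ = τ ⟨X, Y, e⟩) {X Y : A}
    {p : Q.Word X Y} (hp : p.All P) : E.evalWord σ p = E.evalWord τ p := by
  induction p with
  | nil => rfl
  | cons p e ih => rw [evalWord, evalWord, ih hp.1, h e hp.2]

end Eval

variable (G : SemifreeGenerators k A) (σ : ∀ e : Σ X Y, G.Gen X Y, E.M e.1 e.2.1)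

/-- The value `σ e` at the generator `e` is compatible with projection and differential. -/
structure IsLift {X Y : A} (e : G.Gen X Y) : Prop where
  mem : σ ⟨X, Y, e⟩ ∈ E.grading X Y (G.deg e)
  π_eq : E.π (σ ⟨X, Y, e⟩) = G.val e
  d_eq : E.d (G.deg e) (σ ⟨X, Y, e⟩) = E.evalLin σ X Y (G.toDGQuiver.dGen e)

section

variable {E G σ} {X Y : A} {p : G.Word X Y}

/-- Here and in the next two lemmas only the letters of `p` have to be lifts, so the statements
apply inside the induction, to words in generators already treated. -/
theorem evalWord_mem (hp : p.All (E.IsLift G σ)) :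
    E.evalWord σ p ∈ E.grading X Y p.degree := by
  induction p with
  | nil => exact E.one_mem _
  | cons p e ih => exact E.mul_mem (ih hp.1) hp.2.mem

theorem π_evalWord (hp : p.All (E.IsLift G σ)) : E.π (E.evalWord σ p) = p.eval G.val := by
  induction p with
  | nil => exact E.π_one _
  | cons p e ih => rw [evalWord, E.π_mul, ih hp.1, hp.2.π_eq, Word.eval]

theorem d_evalWord (hp : p.All (E.IsLift G σ)) : E.d p.degree (E.evalWord σ p) =
    E.evalLin σ X Y (leibnizWord G.toDGQuiver.dGen p) := by
  induction p with
  | nil => rw [evalWord, leibnizWord, map_zero]; exact E.d_one _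
  | cons p e ih =>
    rw [evalWord, Word.degree, E.leibniz (evalWord_mem hp.1) hp.2.mem, ih hp.1, hp.2.d_eq,
      leibnizWord, map_add, E.evalLin_mul σ (word_mem p), evalLin_word, Units.smul_def,
      Units.smul_def, map_zsmul]
    have h := leibnizExt_mem G.toDGQuiver.dGen G.toDGQuiver.dGen_mem (word_mem (k := k) p)
    rw [leibnizExt_word] at h
    have hs : E.evalLin σ _ _ (word k (Word.single e)) = σ ⟨_, _, e⟩ := by
      rw [evalLin_word]
      exact E.one_mul _
    rw [E.evalLin_mul σ h, hs]

end

/-- The values of the letters that are smaller than a given generator. -/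
noncomputable def truncate (e : Σ X Y, G.Gen X Y)
    (ρ : ∀ e', G.lt e' e → E.M e'.1 e'.2.1) (e' : Σ X Y, G.Gen X Y) : E.M e'.1 e'.2.1 :=
  open Classical in if h : G.lt e' e then ρ e' h else 0

/-- A choice of a value at a generator, given the values at smaller generators. -/
noncomputable def liftStep (e : Σ X Y, G.Gen X Y)
    (ρ : ∀ e', G.lt e' e → E.M e'.1 e'.2.1) : E.M e.1 e.2.1 :=
  -- The default 0 never occurs for the values built by `liftGen`: `isLift_liftGen` shows by
  -- induction that the condition holds.
  open Classical in
  if h : ∃ x ∈ E.grading e.1 e.2.1 (G.deg e.2.2), E.π x = G.val e.2.2 ∧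
    E.d (G.deg e.2.2) x = E.evalLin (E.truncate G e ρ) e.1 e.2.1 (G.toDGQuiver.dGen e.2.2)
  then h.choose else 0

/-- Values at all generators, constructed by recursion. -/
noncomputable def liftGen : ∀ e : Σ X Y, G.Gen X Y, E.M e.1 e.2.1 :=
  G.isWellOrder.toIsWellFounded.wf.fix (E.liftStep G)

/-- The form in which the triangularity condition `d_val_mem` enters the recursion. -/
theorem dGen_mem_supported {X Y : A} (e : G.Gen X Y) : G.toDGQuiver.dGen e ∈
    Finsupp.supported k k {p : G.Word X Y | p.All fun {U V} g => G.lt ⟨U, V, g⟩ ⟨X, Y, e⟩} := by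
  have h := Submodule.mem_map_of_mem (f := (G.expand X Y).toLinearMap) (G.d_val_mem e)
  rw [Submodule.map_span, Set.image_image] at h
  simp only [LinearEquiv.coe_coe, G.expand_eval] at h
  rw [Finsupp.supported_eq_span_single]
  exact h

/-- By induction the lift is compatible with all structure on words in smaller letters. So the value
of de has the right degree, is closed because d(de) = 0, and projects to de in `A`. These are the
hypotheses of `exists_lift`, which provides an admissible value at `e`. -/
theorem isLift_liftGen {X Y : A} (e : G.Gen X Y) : E.IsLift G (E.liftGen G) e := by
  have key : ∀ e : Σ X Y, G.Gen X Y, E.IsLift G (E.liftGen G) e.2.2 := by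
    intro e
    induction e using G.isWellOrder.toIsWellFounded.wf.induction with
    | h e ih =>
    obtain ⟨X, Y, e⟩ := e
    have hall : ∀ p ∈ {p : G.Word X Y | p.All fun {U V} g => G.lt ⟨U, V, g⟩ ⟨X, Y, e⟩},
        p.All (E.IsLift G (E.liftGen G)) := by
      exact fun p hp => hp.mono fun g hg => ih ⟨_, _, g⟩ hg
    have hs := dGen_mem_supported G e
    have hfix : E.liftGen G ⟨X, Y, e⟩ =
        E.liftStep G ⟨X, Y, e⟩ fun e' _ => E.liftGen G e' :=
      G.isWellOrder.toIsWellFounded.wf.fix_eq _ _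
    have htr : E.evalLin (E.truncate G ⟨X, Y, e⟩ fun e' _ => E.liftGen G e') X Y
        (G.toDGQuiver.dGen e) = E.evalLin (E.liftGen G) X Y (G.toDGQuiver.dGen e) := by
      refine eqOn_supported (fun p hp => ?_) hs
      rw [evalLin_word, evalLin_word]
      refine E.evalWord_congr (P := fun {U V} g => G.lt ⟨U, V, g⟩ ⟨X, Y, e⟩)
        (fun g hg => ?_) hp
      exact dif_pos hg
    -- Both restrictions on the words are needed at once: small letters for the induction
    -- hypothesis, and the exact degree because `E.d` takes the degree as an argument.
    have h2 : G.toDGQuiver.dGen e ∈ Finsupp.supported k k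
        ({p : G.Word X Y | p.degree = G.deg e + 1} ∩
          {p : G.Word X Y | p.All fun {U V} g => G.lt ⟨U, V, g⟩ ⟨X, Y, e⟩}) := by
      rw [Finsupp.supported_inter]
      exact ⟨G.toDGQuiver.dGen_mem e, hs⟩
    have hmem : E.evalLin (E.liftGen G) X Y (G.toDGQuiver.dGen e) ∈
        E.grading X Y (G.deg e + 1) := by
      refine map_supported_le (fun p hp => ?_) h2
      rw [evalLin_word, ← hp.1]
      exact evalWord_mem (hall p hp.2)
    have hd : E.d (G.deg e + 1) (E.evalLin (E.liftGen G) X Y (G.toDGQuiver.dGen e)) = 0 := by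
      have h3 := eqOn_supported (f := (E.d (G.deg e + 1)).comp (E.evalLin (E.liftGen G) X Y))
        (g := (E.evalLin (E.liftGen G) X Y).comp (leibnizExt G.toDGQuiver.dGen X Y))
        (fun p hp => by
          rw [LinearMap.comp_apply, LinearMap.comp_apply, evalLin_word, leibnizExt_word, ← hp.1]
          exact d_evalWord (hall p hp.2)) h2
      have h4 := G.toDGQuiver.d_dGen e
      rw [LinearMap.comp_apply, LinearMap.comp_apply, h4, map_zero] at h3
      exact h3
    have hπ : E.π (E.evalLin (E.liftGen G) X Y (G.toDGQuiver.dGen e)) =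
        DGCategory.d (k := k) X Y (G.val e) := by
      have h3 := eqOn_supported (f := E.π.comp (E.evalLin (E.liftGen G) X Y))
        (g := (G.expand X Y).symm.toLinearMap) (fun p hp => by
          rw [LinearMap.comp_apply, evalLin_word, LinearEquiv.coe_coe, G.expand_symm_word]
          exact π_evalWord (hall p hp)) hs
      simpa using h3
    have hex := E.exists_lift (G.val_mem e) hmem hd hπ
    rw [← htr] at hex
    have hval : E.liftGen G ⟨X, Y, e⟩ = hex.choose := hfix.trans (dif_pos hex)
    refine ⟨?_, ?_, ?_⟩
    · rw [hval]; exact hex.choose_spec.1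
    · rw [hval]; exact hex.choose_spec.2.1
    · rw [← htr, hval]; exact hex.choose_spec.2.2
  exact key ⟨X, Y, e⟩

/-- An acyclic extension of a semifree dg category has a section. -/
theorem exists_section (G : SemifreeGenerators k A) : ∃ S : ∀ X Y : A, (X ⟶ Y) →ₗ[k] E.M X Y,
    (∀ {X Y : A} {n : ℤ} {f : X ⟶ Y}, f ∈ DGCategory.grading (k := k) X Y n →
      S X Y f ∈ E.grading X Y n) ∧
    (∀ X : A, S X X (𝟙 X) = E.one X) ∧
    (∀ {X Y Z : A} {n : ℤ} {f : X ⟶ Y} (g : Y ⟶ Z), f ∈ DGCategory.grading (k := k) X Y n →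
      S X Z (f ≫ g) = E.mul n (S X Y f) (S Y Z g)) ∧
    (∀ {X Y : A} {n : ℤ} {f : X ⟶ Y}, f ∈ DGCategory.grading (k := k) X Y n →
      S X Y (DGCategory.d (k := k) X Y f) = E.d n (S X Y f)) ∧
    (∀ {X Y : A} (f : X ⟶ Y), E.π (S X Y f) = f) := by
  have hall : ∀ {X Y : A} (p : G.Word X Y), p.All (E.IsLift G (E.liftGen G)) := by
    intro X Y p
    induction p with
    | nil => trivial
    | cons p e ih => exact ⟨ih, E.isLift_liftGen G e⟩
  refine ⟨fun X Y => (E.evalLin (E.liftGen G) X Y).comp (G.expand X Y).toLinearMap,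
    fun {X Y n f} hf => ?_, fun X => ?_, fun {X Y Z n f} g hf => ?_, fun {X Y n f} hf => ?_,
    fun {X Y} f => ?_⟩
  · refine homog_le (f := E.evalLin (E.liftGen G) X Y) (fun p hp => ?_) (G.expand_mem hf)
    rw [evalLin_word, ← hp]
    exact evalWord_mem (hall p)
  · simp [G.expand_id, evalWord]
  · simp only [LinearMap.comp_apply, LinearEquiv.coe_coe]
    rw [G.expand_comp, E.evalLin_mul _ (G.expand_mem hf)]
  · simp only [LinearMap.comp_apply, LinearEquiv.coe_coe]
    rw [G.expand_d]
    refine homog_ext (f := (E.evalLin (E.liftGen G) X Y).comp (leibnizExt G.toDGQuiver.dGen X Y))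
      (g := (E.d n).comp (E.evalLin (E.liftGen G) X Y)) (fun p hp => ?_) (G.expand_mem hf)
    rw [LinearMap.comp_apply, LinearMap.comp_apply, evalLin_word, leibnizExt_word, ← hp]
    exact (d_evalWord (hall p)).symm
  · have := lin_ext_apply (f := E.π.comp (E.evalLin (E.liftGen G) X Y))
      (g := (G.expand X Y).symm.toLinearMap) (fun p => by
        rw [LinearMap.comp_apply, evalLin_word, LinearEquiv.coe_coe, G.expand_symm_word]
        exact π_evalWord (hall p)) (G.expand X Y f)
    simpa using this

end AcyclicExtension

end DG

/-! ### The extension that encodes a homotopy inverse -/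

namespace DG

namespace DGFunctor

section

variable {k : Type*} [CommRing k]
  {A : Type*} [Category* A] [Preadditive A] [Linear k A] [DGCategory k A]
  {B : Type*} [Category* B] [Preadditive B] [Linear k B] [DGCategory k B]

/-- A homotopy of dg functors, given by its components `t X` at objects, which are homotopy
equivalences, and its components `T f` at all morphisms. -/
structure Homotopy (F₁ F₂ : DGFunctor k A B) where
  t : ∀ X, F₁.obj X ⟶ F₂.obj X
  t_mem : ∀ X, t X ∈ cocycles k (F₁.obj X) (F₂.obj X) 0
  inverse : ∀ X, HomotopyInverse k (t X)
  T : ∀ X Y, (X ⟶ Y) →ₗ[k] (F₁.obj X ⟶ F₂.obj Y)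
  T_mem : ∀ {X Y : A} {n : ℤ} {f : X ⟶ Y}, f ∈ DGCategory.grading (k := k) X Y n →
    T X Y f ∈ DGCategory.grading (k := k) (F₁.obj X) (F₂.obj Y) (n - 1)
  T_comp : ∀ {X Y Z : A} {n : ℤ} {f : X ⟶ Y} (g : Y ⟶ Z),
    f ∈ DGCategory.grading (k := k) X Y n →
      T X Z (f ≫ g) = T X Y f ≫ F₂.map g + n.negOnePow • (F₁.map f ≫ T Y Z g)
  d_T : ∀ {X Y : A} {n : ℤ} {f : X ⟶ Y}, f ∈ DGCategory.grading (k := k) X Y n →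
    DGCategory.d (k := k) _ _ (T X Y f) =
      n.negOnePow • (t X ≫ F₂.map f - F₁.map f ≫ t Y) + T X Y (DGCategory.d (k := k) X Y f)

/-- Precomposition of a homotopy with a dg functor. -/
def Homotopy.whiskerLeft {C : Type*} [Category* C] [Preadditive C] [Linear k C]
    [DGCategory k C] (F : DGFunctor k A B) {F₁ F₂ : DGFunctor k B C} (H : Homotopy F₁ F₂) :
    Homotopy (F.comp F₁) (F.comp F₂) where
  t X := H.t (F.obj X)
  t_mem X := H.t_mem (F.obj X)
  inverse X := H.inverse (F.obj X)
  T X Y := (H.T (F.obj X) (F.obj Y)).comp (F.mapLinear X Y)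
  T_mem hf := H.T_mem (F.map_mem hf)
  T_comp {X Y Z n f} g hf := by
    have h := H.T_comp (F.map g) (F.map_mem hf)
    rw [← F.map_comp] at h
    exact h
  d_T {X Y n f} hf := by
    have h := H.d_T (F.map_mem hf)
    rw [← F.map_d] at h
    exact h

variable (F : DGFunctor k A B)
  (hF : ∀ X Y n, Function.Bijective (F.mapCohomology X Y n)) (o : B → A)
  (t : ∀ X : B, F.obj (o X) ⟶ X) (ht : ∀ X, t X ∈ cocycles k (F.obj (o X)) X 0)
  (I : ∀ X, HomotopyInverse k (t X))

/-- The extension of `B` whose sections are the dg functors `G : B ⟶ A` with values `o` on objects,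
together with a homotopy with components `t` at objects from `G ≫ F` to the identity. -/
noncomputable def inverseExtension : AcyclicExtension k B where
  -- A section is f ↦ (f, G f, T f). The product and differential of the third entry are chosen so
  -- that multiplicativity and compatibility with d become the rules `T_comp` and `d_T` for a
  -- homotopy from `G.comp F` to the identity.
  M X Y := (X ⟶ Y) × (o X ⟶ o Y) × (F.obj (o X) ⟶ Y)
  grading X Y n := (DGCategory.grading (k := k) X Y n).prod
    ((DGCategory.grading (k := k) (o X) (o Y) n).prod
      (DGCategory.grading (k := k) (F.obj (o X)) Y (n - 1)))
  one X := (𝟙 X, 𝟙 (o X), 0)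
  mul {X Y Z} m := LinearMap.mk₂ k (fun x y => (x.1 ≫ y.1, x.2.1 ≫ y.2.1,
      x.2.2 ≫ y.1 + m.negOnePow • (F.map x.2.1 ≫ y.2.2)))
    (fun x x' y => by
      ext <;> simp [F.map_add, Units.smul_def]; abel)
    (fun a x y => by
      ext <;> simp [F.map_smul, Units.smul_def, smul_comm a])
    (fun x y y' => by
      ext <;> simp [Units.smul_def]; abel)
    (fun a x y => by
      ext <;> simp [Units.smul_def, smul_comm a])
  d {X Y} n :=
    { toFun := fun x => (DGCategory.d (k := k) _ _ x.1, DGCategory.d (k := k) _ _ x.2.1,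
        DGCategory.d (k := k) _ _ x.2.2 - n.negOnePow • (t X ≫ x.1 - F.map x.2.1 ≫ t Y))
      map_add' := fun x y => by
        ext <;> simp [F.map_add, Units.smul_def, smul_sub]; abel
      map_smul' := fun a x => by
        ext <;> simp [F.map_smul, Units.smul_def, smul_comm a, smul_sub] }
  π := LinearMap.fst k _ _
  one_mem X := ⟨DGCategory.id_mem X, DGCategory.id_mem (o X), zero_mem _⟩
  mul_mem {X Y Z m n x y} hx hy := ⟨DGCategory.comp_mem hx.1 hy.1,
    DGCategory.comp_mem hx.2.1 hy.2.1, add_mem (comp_mem' hx.2.2 hy.1 (by ring))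
      (units_smul_mem _ _ (comp_mem' (F.map_mem hx.2.1) hy.2.2 (by ring)))⟩
  mul_one m x := by ext <;> simp
  one_mul x := by ext <;> simp
  mul_assoc m n x y z := by
    ext <;> simp [Int.negOnePow_add, mul_smul, Units.smul_def]; abel
  d_one X := by
    have h (Z : B) : DGCategory.d (k := k) Z Z (𝟙 Z) = 0 := (id_mem_cocycles k Z).2
    have h' (Z : A) : DGCategory.d (k := k) Z Z (𝟙 Z) = 0 := (id_mem_cocycles k Z).2
    ext <;> simp [h, h']
  leibniz {X Y Z m n x y} hx hy := by
    ext
    · exact DGCategory.leibniz _ hy.1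
    · exact DGCategory.leibniz _ hy.2.1
    · have h1 := DGCategory.leibniz x.2.2 hy.1
      have h2 := DGCategory.leibniz (F.map x.2.1) hy.2.2
      simp only [LinearMap.mk₂_apply, LinearMap.coe_mk, AddHom.coe_mk, Prod.snd_add,
        Units.smul_def, Prod.smul_snd, _root_.map_add, map_zsmul] at h1 h2 ⊢
      rw [h1, h2]
      simp only [Int.negOnePow_add, Int.negOnePow_sub, F.map_comp, F.map_d, Int.negOnePow_one]
      rcases Int.units_eq_one_or m.negOnePow with hm | hm <;>
      rcases Int.units_eq_one_or n.negOnePow with hn | hn <;>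
      simp [hm, hn] <;> abel
  π_one X := rfl
  π_mul m x y := rfl
  exists_lift {X Y n f z} hf hz hd hπ := by
    obtain ⟨z₀, z₁, z₂⟩ := z
    obtain rfl : z₀ = _ := hπ
    have hd1 : DGCategory.d (k := k) _ _ z₁ = 0 := congrArg (fun x => x.2.1) hd
    have hd2 : DGCategory.d (k := k) _ _ z₂ - (n + 1).negOnePow •
      (t X ≫ DGCategory.d (k := k) _ _ f - F.map z₁ ≫ t Y) = 0 := congrArg (fun x => x.2.2) hd
    have hz2 : z₂ ∈ DGCategory.grading (k := k) _ _ n := by simpa using hz.2.2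
    -- For a lift (f, g, r) one needs dg = z₁ and dr = z₂ + (-1)^n (t ≫ f - F g ≫ t). The second
    -- equation asks that F g ≫ t differ from this `y` by an exact morphism ds, with r = -(-1)^n s;
    -- closedness of z says dy = F z₁ ≫ t.
    obtain ⟨g, hg, s, hs, e₁, e₂⟩ := exists_primitive_comp (hF (o X) (o Y)) (ht Y) (I Y)
      (z := z₁) (y := t X ≫ f + n.negOnePow • z₂) ⟨hz.2.1, hd1⟩
      (add_mem (comp_mem' (ht X).1 hf (zero_add _)) (units_smul_mem _ _ hz2)) (by
        rw [_root_.map_add, d_closed_comp (ht X).2 hf, d_units_smul, sub_eq_zero.mp hd2,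
          Int.negOnePow_succ, smul_smul]
        simp)
    refine ⟨(f, g, -(n.negOnePow • s)), ⟨hf, hg, neg_mem (units_smul_mem _ _ hs)⟩, rfl, ?_⟩
    ext
    · rfl
    · exact e₁
    · change DGCategory.d (k := k) _ _ (-(n.negOnePow • s)) -
        n.negOnePow • (t X ≫ f - F.map g ≫ t Y) = z₂
      rw [map_neg, d_units_smul, ← e₂]
      rcases Int.units_eq_one_or n.negOnePow with hn | hn <;> simp [hn]

end

end DGFunctor

end DG

/-! ### Construction of the inverse, and the extension that encodes lifted homotopies -/

namespace DG

namespace DGFunctor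

section

variable {k : Type*} [CommRing k]
  {A : Type*} [Category* A] [Preadditive A] [Linear k A] [DGCategory k A]
  {B : Type*} [Category* B] [Preadditive B] [Linear k B] [DGCategory k B]
  {C : Type*} [Category* C] [Preadditive C] [Linear k C] [DGCategory k C]

/-- A dg functor into a semifree dg category that is bijective on cohomology has a homotopy right
inverse with prescribed values on objects. -/
theorem exists_homotopy_comp_id (GB : SemifreeGenerators k B) (F : DGFunctor k A B)
    (hF : ∀ X Y n, Function.Bijective (F.mapCohomology X Y n)) (o : B → A)
    (t : ∀ X : B, F.obj (o X) ⟶ X) (ht : ∀ X, t X ∈ cocycles k (F.obj (o X)) X 0)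
    (I : ∀ X, HomotopyInverse k (t X)) :
    ∃ G : DGFunctor k B A, Nonempty (Homotopy (G.comp F) (DGFunctor.id k B)) := by
  obtain ⟨S, S_mem, S_one, S_mul, S_d, S_π⟩ := (inverseExtension F hF o t ht I).exists_section GB
  let S₂ : ∀ X Y : B, (X ⟶ Y) →ₗ[k] (o X ⟶ o Y) := fun X Y =>
    (LinearMap.fst k (o X ⟶ o Y) (F.obj (o X) ⟶ Y)).comp
      ((LinearMap.snd k (X ⟶ Y) ((o X ⟶ o Y) × (F.obj (o X) ⟶ Y))).comp (S X Y))
  let S₃ : ∀ X Y : B, (X ⟶ Y) →ₗ[k] (F.obj (o X) ⟶ Y) := fun X Y =>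
    (LinearMap.snd k (o X ⟶ o Y) (F.obj (o X) ⟶ Y)).comp
      ((LinearMap.snd k (X ⟶ Y) ((o X ⟶ o Y) × (F.obj (o X) ⟶ Y))).comp (S X Y))
  have hS {X Y : B} (f : X ⟶ Y) : S X Y f = (f, S₂ X Y f, S₃ X Y f) := Prod.ext (S_π f) rfl
  -- The section is multiplicative, and compatible with d, only for homogeneous `f`; in the
  -- component `S₂` no signs occur, so both identities extend by linearity.
  have h_comp {X Y Z : B} (f : X ⟶ Y) (g : Y ⟶ Z) :
      S₂ X Z (f ≫ g) = S₂ X Y f ≫ S₂ Y Z g := by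
    have h := DGCategory.linear_ext (φ := (S₂ X Z).comp (Linear.rightComp k X g))
      (ψ := (Linear.rightComp k (o X) (S₂ Y Z g)).comp (S₂ X Y))
      (fun n f hf => congrArg (fun x => x.2.1) (S_mul g hf))
    exact LinearMap.congr_fun h f
  have h_d {X Y : B} (f : X ⟶ Y) : S₂ X Y (DGCategory.d (k := k) X Y f) =
      DGCategory.d (k := k) _ _ (S₂ X Y f) := by
    have h := DGCategory.linear_ext (φ := (S₂ X Y).comp (DGCategory.d (k := k) X Y))
      (ψ := (DGCategory.d (k := k) _ _).comp (S₂ X Y))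
      (fun n f hf => congrArg (fun x => x.2.1) (S_d hf))
    exact LinearMap.congr_fun h f
  let G : DGFunctor k B A :=
    { obj := o
      map := fun {X Y} f => S₂ X Y f
      map_id := fun X => congrArg (fun x => x.2.1) (S_one X)
      map_comp := h_comp
      map_add := fun f g => _root_.map_add (S₂ _ _) f g
      map_smul := fun a f => _root_.map_smul (S₂ _ _) a f
      map_mem := fun hf => (S_mem hf).2.1
      map_d := h_d }
  exact ⟨G, ⟨{
    t := t
    t_mem := ht
    inverse := I
    T := S₃
    T_mem := fun hf => (S_mem hf).2.2
    T_comp := fun {X Y Z n f} g hf => by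
      have h := congrArg (fun x => x.2.2) (S_mul g hf)
      rw [hS f, hS g] at h
      exact h
    d_T := fun {X Y n f} hf => by
      have h := congrArg (fun x => x.2.2) (S_d hf)
      rw [hS f] at h
      exact (eq_add_of_sub_eq' h.symm).trans rfl }⟩⟩

/-- Change of a homotopy by morphisms of degree `-1`. -/
noncomputable def Homotopy.modify {F₁ F₂ : DGFunctor k A B} (K : Homotopy F₁ F₂)
    (s : ∀ X, F₁.obj X ⟶ F₂.obj X)
    (hs : ∀ X, s X ∈ DGCategory.grading (k := k) (F₁.obj X) (F₂.obj X) (-1))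
    (t : ∀ X, F₁.obj X ⟶ F₂.obj X) (ht : ∀ X, t X - K.t X = DGCategory.d (k := k) _ _ (s X))
    (I : ∀ X, HomotopyInverse k (t X)) : Homotopy F₁ F₂ where
  t := t
  t_mem X := by
    rw [sub_eq_iff_eq_add.mp (ht X)]
    exact add_mem ⟨d_mem' (hs X) (by ring), DGCategory.d_d _⟩ (K.t_mem X)
  inverse := I
  -- Adding ds to t changes T by the graded commutator s ≫ F₂ f - (-1)^|f| F₁ f ≫ s;
  -- `signInvolution` makes this linear in `f`.
  T X Y := K.T X Y + ((Linear.leftComp k (F₂.obj Y) (s X)).comp (F₂.mapLinear X Y) -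
    (Linear.rightComp k (F₁.obj X) (s Y)).comp ((F₁.mapLinear X Y).comp (signInvolution k X Y)))
  T_mem {X Y n f} hf := by
    refine add_mem (K.T_mem hf) (sub_mem (comp_mem' (hs X) (F₂.map_mem hf) (by ring)) ?_)
    rw [LinearMap.comp_apply, LinearMap.comp_apply, signInvolution_apply hf]
    exact comp_mem' (F₁.map_mem (units_smul_mem _ _ hf)) (hs Y) (by ring)
  T_comp {X Y Z n f} g hf := by
    -- In `T_comp` the second factor need not be homogeneous, so the sign rule for f ≫ g is checked
    -- for homogeneous `g` and extended linearly.
    have h := DGCategory.linear_ext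
      (φ := (F₁.mapLinear X Z).comp ((signInvolution k X Z).comp (Linear.leftComp k Z f)))
      (ψ := (n.negOnePow : ℤ) • (Linear.leftComp k (F₁.obj Z) (F₁.map f)).comp
        ((F₁.mapLinear Y Z).comp (signInvolution k Y Z))) (fun m g hg => by
          simp only [LinearMap.comp_apply, LinearMap.smul_apply, Linear.leftComp_apply]
          rw [signInvolution_apply hg, signInvolution_apply (DGCategory.comp_mem hf hg)]
          simp [Units.smul_def, mapLinear, Int.negOnePow_add, mul_smul])
    have h' := LinearMap.congr_fun h g
    simp only [LinearMap.comp_apply, LinearMap.smul_apply, Linear.leftComp_apply] at h'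
    simp only [LinearMap.add_apply, LinearMap.sub_apply, LinearMap.comp_apply,
      Linear.leftComp_apply, Linear.rightComp_apply, K.T_comp g hf, h', signInvolution_apply hf]
    change _ + (s X ≫ F₂.map (f ≫ g) - _) = (_ + (s X ≫ F₂.map f - F₁.map _ ≫ s Y)) ≫ _ +
      n.negOnePow • (_ ≫ (_ + (s Y ≫ F₂.map g - F₁.map _ ≫ _)))
    rw [map_units_smul]
    rcases Int.units_eq_one_or n.negOnePow with hn | hn <;> simp [hn, mapLinear] <;> abel
  d_T {X Y n f} hf := by
    have h1 := DGCategory.leibniz (s X) (F₂.map_mem hf)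
    have h2 := DGCategory.leibniz (F₁.map f) (hs Y)
    simp only [LinearMap.add_apply, LinearMap.sub_apply, LinearMap.comp_apply,
      Linear.leftComp_apply, Linear.rightComp_apply, signInvolution_apply hf,
      signInvolution_apply (DGCategory.d_mem hf), _root_.map_add, _root_.map_sub, K.d_T hf]
    change _ + (DGCategory.d (k := k) _ _ (s X ≫ F₂.map f) -
      DGCategory.d (k := k) _ _ (F₁.map _ ≫ s Y)) = _ + (_ + (s X ≫ F₂.map _ - F₁.map _ ≫ s Y))
    rw [map_units_smul, map_units_smul, F₁.map_d, F₂.map_d, Linear.units_smul_comp,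
      d_units_smul, h1, h2, ← ht, ← ht]
    rcases Int.units_eq_one_or n.negOnePow with hn | hn <;>
      simp [hn, Int.negOnePow_succ] <;> abel

variable {F₁ F₂ : DGFunctor k A B} (P : DGFunctor k B C)
  (hP : ∀ X Y n, Function.Bijective (P.mapCohomology X Y n))
  (t : ∀ X, F₁.obj X ⟶ F₂.obj X) (ht : ∀ X, t X ∈ cocycles k (F₁.obj X) (F₂.obj X) 0)
  (K : ∀ X Y, (X ⟶ Y) →ₗ[k] (P.obj (F₁.obj X) ⟶ P.obj (F₂.obj Y)))
  (K_mem : ∀ {X Y : A} {n : ℤ} {f : X ⟶ Y}, f ∈ DGCategory.grading (k := k) X Y n →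
    K X Y f ∈ DGCategory.grading (k := k) (P.obj (F₁.obj X)) (P.obj (F₂.obj Y)) (n - 1))
  (K_comp : ∀ {X Y Z : A} {n : ℤ} {f : X ⟶ Y} (g : Y ⟶ Z),
    f ∈ DGCategory.grading (k := k) X Y n →
      K X Z (f ≫ g) = K X Y f ≫ P.map (F₂.map g) + n.negOnePow • (P.map (F₁.map f) ≫ K Y Z g))
  (d_K : ∀ {X Y : A} {n : ℤ} {f : X ⟶ Y}, f ∈ DGCategory.grading (k := k) X Y n →
    DGCategory.d (k := k) _ _ (K X Y f) =
      n.negOnePow • (P.map (t X) ≫ P.map (F₂.map f) - P.map (F₁.map f) ≫ P.map (t Y)) +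
        K X Y (DGCategory.d (k := k) X Y f))

/-- The extension of `A` whose sections are the homotopies `F₁ ⟶ F₂` with components `t` at objects,
together with a homotopy of homotopies from their images under `P` to
`K`. -/
noncomputable def homotopyExtension : AcyclicExtension k A where
  -- A section is f ↦ (f, T f, L f), where d(L f) = L(df) + (-1)^n (P (T f) - K f). As L lowers
  -- degrees by 2, its product rule carries no sign.
  M X Y := (X ⟶ Y) × (F₁.obj X ⟶ F₂.obj Y) × (P.obj (F₁.obj X) ⟶ P.obj (F₂.obj Y))
  grading X Y n := (DGCategory.grading (k := k) X Y n).prod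
    ((DGCategory.grading (k := k) (F₁.obj X) (F₂.obj Y) (n - 1)).prod
      (DGCategory.grading (k := k) (P.obj (F₁.obj X)) (P.obj (F₂.obj Y)) (n - 1 - 1)))
  one X := (𝟙 X, 0, 0)
  mul {X Y Z} m := LinearMap.mk₂ k (fun x y => (x.1 ≫ y.1,
      x.2.1 ≫ F₂.map y.1 + m.negOnePow • (F₁.map x.1 ≫ y.2.1),
      x.2.2 ≫ P.map (F₂.map y.1) + P.map (F₁.map x.1) ≫ y.2.2))
    (fun x x' y => by
      ext <;> simp [DGFunctor.map_add, Units.smul_def] <;> abel)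
    (fun a x y => by
      ext <;> simp [DGFunctor.map_smul, Units.smul_def, smul_comm a])
    (fun x y y' => by
      ext <;> simp [DGFunctor.map_add, Units.smul_def] <;> abel)
    (fun a x y => by
      ext <;> simp [DGFunctor.map_smul, Units.smul_def, smul_comm a])
  d {X Y} n :=
    { toFun := fun x => (DGCategory.d (k := k) _ _ x.1,
        DGCategory.d (k := k) _ _ x.2.1 - n.negOnePow • (t X ≫ F₂.map x.1 - F₁.map x.1 ≫ t Y),
        DGCategory.d (k := k) _ _ x.2.2 - n.negOnePow • (P.map x.2.1 - K X Y x.1))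
      map_add' := fun x y => by
        ext <;> simp [DGFunctor.map_add, Units.smul_def, smul_sub] <;> abel
      map_smul' := fun a x => by
        ext <;> simp [DGFunctor.map_smul, Units.smul_def, smul_comm a, smul_sub] }
  π := LinearMap.fst k _ _
  one_mem X := ⟨DGCategory.id_mem X, zero_mem _, zero_mem _⟩
  mul_mem {X Y Z m n x y} hx hy := ⟨DGCategory.comp_mem hx.1 hy.1,
    add_mem (comp_mem' hx.2.1 (F₂.map_mem hy.1) (by ring))
      (units_smul_mem _ _ (comp_mem' (F₁.map_mem hx.1) hy.2.1 (by ring))),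
    add_mem (comp_mem' hx.2.2 (P.map_mem (F₂.map_mem hy.1)) (by ring))
      (comp_mem' (P.map_mem (F₁.map_mem hx.1)) hy.2.2 (by ring))⟩
  mul_one m x := by ext <;> simp
  one_mul x := by ext <;> simp
  mul_assoc m n x y z := by
    ext <;> simp [Int.negOnePow_add, mul_smul, Units.smul_def] <;> abel
  d_one X := by
    have h (Z : A) : DGCategory.d (k := k) Z Z (𝟙 Z) = 0 := (id_mem_cocycles k Z).2
    -- The product rule at 1 = 1 ≫ 1 gives K(1) = K(1) + K(1).
    have h' : K X X (𝟙 X) = 0 := by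
      have := K_comp (𝟙 X) (DGCategory.id_mem (k := k) X)
      simpa using this
    ext <;> simp [h, h', DGFunctor.map_zero]
  leibniz {X Y Z m n x y} hx hy := by
    ext
    · exact DGCategory.leibniz _ hy.1
    · have h1 := DGCategory.leibniz x.2.1 (F₂.map_mem hy.1)
      have h2 := DGCategory.leibniz (F₁.map x.1) hy.2.1
      simp only [LinearMap.mk₂_apply, LinearMap.coe_mk, AddHom.coe_mk, Prod.snd_add, Prod.fst_add,
        Units.smul_def, Prod.smul_snd, Prod.smul_fst, _root_.map_add, map_zsmul] at h1 h2 ⊢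
      rw [h1, h2]
      simp only [Int.negOnePow_add, Int.negOnePow_sub, Functor.map_comp, DGFunctor.map_d,
        Int.negOnePow_one]
      rcases Int.units_eq_one_or m.negOnePow with hm | hm <;>
      rcases Int.units_eq_one_or n.negOnePow with hn | hn <;>
      simp [hm, hn] <;> abel
    · have h1 := DGCategory.leibniz x.2.2 (P.map_mem (F₂.map_mem hy.1))
      have h2 := DGCategory.leibniz (P.map (F₁.map x.1)) hy.2.2
      have h3 := K_comp y.1 hx.1
      simp only [LinearMap.mk₂_apply, LinearMap.coe_mk, AddHom.coe_mk, Prod.snd_add,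
        Prod.smul_snd, _root_.map_add, h3, DGFunctor.map_add, map_units_smul,
        Functor.map_comp]
      rw [h1, h2]
      simp only [Int.negOnePow_add, Int.negOnePow_sub, DGFunctor.map_d,
        Int.negOnePow_one]
      rcases Int.units_eq_one_or m.negOnePow with hm | hm <;>
      rcases Int.units_eq_one_or n.negOnePow with hn | hn <;>
      simp [hm, hn] <;> abel
  π_one X := rfl
  π_mul m x y := rfl
  exists_lift {X Y n f z} hf hz hd hπ := by
    obtain ⟨z₀, z₁, z₂⟩ := z
    obtain rfl : z₀ = _ := hπ
    have hd1 : DGCategory.d (k := k) _ _ z₁ - (n + 1).negOnePow •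
      (t X ≫ F₂.map (DGCategory.d (k := k) _ _ f) - F₁.map (DGCategory.d (k := k) _ _ f) ≫ t Y)
        = 0 := congrArg (fun x => x.2.1) hd
    have hd2 : DGCategory.d (k := k) _ _ z₂ - (n + 1).negOnePow •
      (P.map z₁ - K X Y (DGCategory.d (k := k) _ _ f)) = 0 := congrArg (fun x => x.2.2) hd
    have hz1 : z₁ ∈ DGCategory.grading (k := k) _ _ n := by simpa using hz.2.1
    have hz2 : z₂ ∈ DGCategory.grading (k := k) _ _ (n - 1) := by simpa using hz.2.2
    have hKf := d_K hf
    -- The differential of a lift (f, g, r) is z when dg is the cocycle below and P g - y is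
    -- d((-1)^n r). That P of this cocycle equals dy follows from `d_K` and the closedness of z.
    obtain ⟨g, hg, s, hs, e₁, e₂⟩ := exists_primitive (hP (F₁.obj X) (F₂.obj Y)) (n := n - 1)
      (z := z₁ + n.negOnePow • (t X ≫ F₂.map f - F₁.map f ≫ t Y))
      (y := K X Y f - n.negOnePow • z₂)
      (mem_cocycles_iff.mpr ⟨by
        rw [sub_add_cancel]
        exact add_mem hz1 (units_smul_mem _ _ (sub_mem
          (comp_mem' (ht X).1 (F₂.map_mem hf) (by ring))
          (comp_mem' (F₁.map_mem hf) (ht Y).1 (by ring)))), by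
        rw [_root_.map_add, d_units_smul, _root_.map_sub, d_closed_comp (ht X).2 (F₂.map_mem hf),
          d_comp_cocycle _ (ht Y), sub_eq_zero.mp hd1, Int.negOnePow_succ, F₁.map_d, F₂.map_d]
        simp⟩)
      (sub_mem (K_mem hf) (units_smul_mem _ _ hz2)) (by
        rw [P.map_add, map_units_smul, P.map_sub, P.map_comp, P.map_comp, _root_.map_sub,
          hKf, d_units_smul, sub_eq_zero.mp hd2, Int.negOnePow_succ, smul_smul]
        simp
        abel)
    refine ⟨(f, g, n.negOnePow • s), ⟨hf, hg, units_smul_mem _ _ hs⟩, rfl, ?_⟩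
    ext
    · rfl
    · change DGCategory.d (k := k) _ _ g - n.negOnePow • (t X ≫ F₂.map f - F₁.map f ≫ t Y) = z₁
      rw [e₁]
      simp
    · change DGCategory.d (k := k) _ _ (n.negOnePow • s) -
        n.negOnePow • (P.map g - K X Y f) = z₂
      rw [d_units_smul, ← e₂]
      rcases Int.units_eq_one_or n.negOnePow with hn | hn <;> simp [hn]

end

end DGFunctor

end DG

/-! ### Lifting homotopy inverses and homotopies along quasi-isomorphisms on morphisms -/

namespace DG

open GradedQuiver

namespace HomotopyInverse

variable {k : Type*} [CommRing k]
  {A : Type*} [Category* A] [Preadditive A] [Linear k A] [DGCategory k A]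
  {B : Type*} [Category* B] [Preadditive B] [Linear k B] [DGCategory k B]
  {X Y : A} {t : X ⟶ Y}

theorem comp_inv_mem (I : HomotopyInverse k t) : 𝟙 X - t ≫ I.inv ∈ coboundaries k X X 0 :=
  ⟨I.hat, I.hat_mem, I.d_hat⟩

theorem inv_comp_mem (I : HomotopyInverse k t) : 𝟙 Y - I.inv ≫ t ∈ coboundaries k Y Y 0 :=
  ⟨I.check, I.check_mem, I.d_check⟩

/-- The image of a coherent homotopy inverse under a dg functor. -/
def map (F : DGFunctor k A B) (I : HomotopyInverse k t) : HomotopyInverse k (F.map t) where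
  inv := F.map I.inv
  hat := F.map I.hat
  check := F.map I.check
  bar := F.map I.bar
  inv_mem := F.map_mem_cocycles I.inv_mem
  hat_mem := F.map_mem I.hat_mem
  check_mem := F.map_mem I.check_mem
  bar_mem := F.map_mem I.bar_mem
  d_hat := by rw [← F.map_d, I.d_hat, F.map_sub, F.map_id, F.map_comp]
  d_check := by rw [← F.map_d, I.d_check, F.map_sub, F.map_id, F.map_comp]
  d_bar := by rw [← F.map_d, I.d_bar, F.map_sub, F.map_comp, F.map_comp]

end HomotopyInverse

namespace DGFunctor

section

variable {k : Type*} [CommRing k]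
  {A : Type*} [Category* A] [Preadditive A] [Linear k A] [DGCategory k A]
  {B : Type*} [Category* B] [Preadditive B] [Linear k B] [DGCategory k B]
  {C : Type*} [Category* C] [Preadditive C] [Linear k C] [DGCategory k C]

/-- A homotopy equivalence in the target of a dg functor that is bijective on cohomology lifts, up
to a coboundary, to a homotopy equivalence in the source. -/
theorem exists_lift_homotopyInverse (P : DGFunctor k B C)
    (hP : ∀ X Y n, Function.Bijective (P.mapCohomology X Y n)) {X Y : B}
    {u : P.obj X ⟶ P.obj Y} (hu : u ∈ cocycles k (P.obj X) (P.obj Y) 0)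
    (I : HomotopyInverse k u) :
    ∃ t ∈ cocycles k X Y 0, Nonempty (HomotopyInverse k t) ∧
      ∃ s ∈ DGCategory.grading (k := k) (P.obj X) (P.obj Y) (-1),
        P.map t - u = DGCategory.d (k := k) _ _ s := by
  obtain ⟨t, ht, htu⟩ := (P.mapCohomology_surjective_iff X Y 0).mp (hP _ _ _).2 u hu
  obtain ⟨t', ht', htu'⟩ := (P.mapCohomology_surjective_iff Y X 0).mp (hP _ _ _).2 I.inv I.inv_mem
  have hPt : P.map t ∈ cocycles k _ _ 0 := P.map_mem_cocycles ht
  have hPt' : P.map t' ∈ cocycles k _ _ 0 := P.map_mem_cocycles ht'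
  refine ⟨t, ht, nonempty_homotopyInverse ht ht' ?_ ?_, ?_⟩
  · refine (P.mapCohomology_injective_iff X X 0).mp (hP _ _ _).1 _
      (sub_mem (id_mem_cocycles k X) (comp_mem_cocycles k ht ht')) ?_
    -- With u' = `I.inv`: P(1 - t ≫ t') = (1 - u ≫ u') - (P t - u) ≫ u' - P t ≫ (P t' - u'), a
    -- combination of coboundaries.
    have h := sub_mem (sub_mem I.comp_inv_mem (coboundary_comp_cocycle htu I.inv_mem))
      (cocycle_comp_coboundary hPt htu')
    convert h using 1
    simp [P.map_sub]
  · refine (P.mapCohomology_injective_iff Y Y 0).mp (hP _ _ _).1 _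
      (sub_mem (id_mem_cocycles k Y) (comp_mem_cocycles k ht' ht)) ?_
    have h := sub_mem (sub_mem I.inv_comp_mem (coboundary_comp_cocycle htu' hu))
      (cocycle_comp_coboundary hPt' htu)
    convert h using 1
    simp [P.map_sub]
  · obtain ⟨s, hs, e⟩ := htu
    exact ⟨s, by simpa using hs, e.symm⟩

/-- Homotopies between dg functors on a semifree dg category lift along dg functors that are
bijective on cohomology. -/
theorem nonempty_homotopy_of_comp (GA : SemifreeGenerators k A) {F₁ F₂ : DGFunctor k A B}
    (P : DGFunctor k B C) (hP : ∀ X Y n, Function.Bijective (P.mapCohomology X Y n))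
    (K : Homotopy (F₁.comp P) (F₂.comp P)) : Nonempty (Homotopy F₁ F₂) := by
  choose t ht hI s hs e using fun X =>
    exists_lift_homotopyInverse P hP (X := F₁.obj X) (Y := F₂.obj X) (K.t_mem X) (K.inverse X)
  let I := fun X => (hI X).some
  -- The components of `K` agree with the P(t X) only up to coboundaries, whereas
  -- `homotopyExtension` needs equality.
  let K' := K.modify s hs (fun X => P.map (t X)) e (fun X => (I X).map P)
  obtain ⟨S, S_mem, S_one, S_mul, S_d, S_π⟩ :=
    (homotopyExtension (F₁ := F₁) (F₂ := F₂) P hP t ht K'.T K'.T_mem K'.T_comp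
      K'.d_T).exists_section GA
  let S₂ : ∀ X Y : A, (X ⟶ Y) →ₗ[k] (F₁.obj X ⟶ F₂.obj Y) := fun X Y =>
    (LinearMap.fst k (F₁.obj X ⟶ F₂.obj Y) (P.obj (F₁.obj X) ⟶ P.obj (F₂.obj Y))).comp
      ((LinearMap.snd k (X ⟶ Y) ((F₁.obj X ⟶ F₂.obj Y) ×
        (P.obj (F₁.obj X) ⟶ P.obj (F₂.obj Y)))).comp (S X Y))
  have hS {X Y : A} (f : X ⟶ Y) : S X Y f = (f, S₂ X Y f, (S X Y f).2.2) := Prod.ext (S_π f) rfl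
  exact ⟨{
    t := t
    t_mem := ht
    inverse := I
    T := S₂
    T_mem := fun hf => (S_mem hf).2.1
    T_comp := fun {X Y Z n f} g hf => by
      have h := congrArg (fun x => x.2.1) (S_mul g hf)
      rw [hS f, hS g] at h
      exact h
    d_T := fun {X Y n f} hf => by
      have h := congrArg (fun x => x.2.1) (S_d hf)
      rw [hS f] at h
      exact (eq_add_of_sub_eq' h.symm).trans rfl }⟩

end

end DGFunctor

/-! ### The universal property of a free dg category -/

namespace FreeDG

section

variable {k : Type*} [CommRing k] {B : Type*} [Category* B] {O : Type u}
  {Q : GradedQuiver.{w} O} (obj : O → B)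
  (val : ∀ {X Y : O}, Q.Gen X Y → (obj X ⟶ obj Y))

/-- The composite of the images of the letters of a word. -/
def evalWord {X : O} : ∀ {Y : O}, Q.Word X Y → (obj X ⟶ obj Y)
  | _, .nil => 𝟙 (obj X)
  | _, .cons p e => evalWord p ≫ val e

theorem evalWord_comp {X Y Z : O} (p : Q.Word X Y) (q : Q.Word Y Z) :
    evalWord obj val (p.comp q) = evalWord obj val p ≫ evalWord obj val q := by
  induction q with
  | nil => simp [evalWord]
  | cons q e ih => simp [evalWord, ih]

variable [Preadditive B] [Linear k B]

variable (k) in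
/-- The linear extension of `evalWord`. -/
noncomputable def evalLin (X Y : O) : Q.Lin k X Y →ₗ[k] (obj X ⟶ obj Y) :=
  Finsupp.linearCombination k (evalWord obj val)

@[simp] theorem evalLin_word {X Y : O} (p : Q.Word X Y) :
    evalLin k obj val X Y (word k p) = evalWord obj val p := by
  simp [evalLin, word]

theorem evalLin_mul {X Y Z : O} (x : Q.Lin k X Y) (y : Q.Lin k Y Z) :
    evalLin k obj val X Z (mul x y) = evalLin k obj val X Y x ≫ evalLin k obj val Y Z y := by
  refine lin_ext_apply (f := (evalLin k obj val X Z).comp (mul.flip y))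
    (g := (Linear.rightComp k _ (evalLin k obj val Y Z y)).comp (evalLin k obj val X Y))
    (fun p => ?_) x
  refine lin_ext_apply (f := (evalLin k obj val X Z).comp (mul (word k p)))
    (g := (Linear.leftComp k _ (evalLin k obj val X Y (word k p))).comp (evalLin k obj val Y Z))
    (fun q => ?_) y
  simp [evalWord_comp]

theorem evalLin_single {X Y : O} (e : Q.Gen X Y) :
    evalLin k obj val X Y (word k (.single e)) = val e := by
  simp [Word.single, evalWord]

end

variable {k : Type*} [CommRing k] {B : Type*} [Category* B] [Preadditive B] [Linear k B]
  [DGCategory k B] {O : Type u} (D : DGQuiver.{w} k O) (obj : O → B)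
  (val : ∀ {X Y : O}, D.Gen X Y → (obj X ⟶ obj Y))
  (val_mem : ∀ {X Y : O} (e : D.Gen X Y),
    val e ∈ DGCategory.grading (k := k) (obj X) (obj Y) (D.deg e))
  (d_val : ∀ {X Y : O} (e : D.Gen X Y),
    DGCategory.d (k := k) _ _ (val e) = evalLin k obj val X Y (D.dGen e))

include val_mem in
theorem evalLin_mem {X Y : O} {n : ℤ} {x : D.Lin k X Y} (hx : x ∈ D.homog k X Y n) :
    evalLin k obj val X Y x ∈ DGCategory.grading (k := k) (obj X) (obj Y) n := by
  refine homog_le (f := evalLin k obj val X Y) (fun p hp => ?_) hx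
  subst hp
  rw [evalLin_word]
  clear hx x
  induction p with
  | nil => exact DGCategory.id_mem _
  | cons p e ih => exact DGCategory.comp_mem ih (val_mem e)

-- Both differentials obey the Leibniz rule, so agreement on generators suffices.
include val_mem d_val in
theorem evalLin_diff {X Y : O} (x : D.Lin k X Y) : evalLin k obj val X Y (D.diff X Y x) =
    DGCategory.d (k := k) _ _ (evalLin k obj val X Y x) := by
  refine lin_ext_apply (f := (evalLin k obj val X Y).comp (D.diff X Y))
    (g := (DGCategory.d (k := k) _ _).comp (evalLin k obj val X Y)) (fun p => ?_) x
  simp only [LinearMap.comp_apply, leibnizExt_word, evalLin_word]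
  clear x
  induction p with
  | nil =>
    rw [leibnizWord, map_zero]
    exact (mem_cocycles_iff.mp (id_mem_cocycles k (obj X))).2.symm
  | cons p e ih =>
    rw [leibnizWord, map_add, Units.smul_def, map_zsmul, evalLin_mul, evalLin_mul,
      ih, evalLin_single, evalLin_word, ← d_val, evalWord,
      DGCategory.leibniz _ (val_mem e), Units.smul_def]

/-- The dg functor on a free dg category with given values at the generators. -/
noncomputable def lift : DGFunctor k (FreeDG D) B where
  obj X := obj X.obj
  map {X Y} f := evalLin k obj val X.obj Y.obj f
  map_id X := evalLin_word obj val (.nil : D.Word X.obj X.obj)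
  map_comp f g := evalLin_mul obj val f g
  map_add f g := _root_.map_add (evalLin k obj val _ _) f g
  map_smul a f := _root_.map_smul (evalLin k obj val _ _) a f
  map_mem hf := evalLin_mem D obj val val_mem hf
  map_d f := evalLin_diff D obj val val_mem d_val f

end FreeDG

/-! ### Homotopies as dg functors on the cylinder -/

namespace DGFunctor

section

variable {k : Type*} [CommRing k]
  {A : Type*} [Category* A] [Preadditive A] [Linear k A] [DGCategory k A]
  {B : Type*} [Category* B] [Preadditive B] [Linear k B] [DGCategory k B]

namespace Homotopy

variable {F₁ F₂ : DGFunctor k A B} (H : Homotopy F₁ F₂) (GA : SemifreeGenerators k A)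

variable (F₁ F₂) in
/-- The dg functor at an end of a cylinder. -/
def atEnd : Bool → DGFunctor k A B
  | false => F₁
  | true => F₂

variable (F₁ F₂) in
/-- The values at objects of the dg functor on the cylinder given by a homotopy. -/
def cylObj (X : A × Bool) : B := (atEnd F₁ F₂ X.2).obj X.1

/-- The values at generators of the dg functor on the cylinder given by a homotopy. -/
def cylVal : ∀ {X Y : A × Bool}, CylGen GA.toGradedQuiver X Y →
    (cylObj F₁ F₂ X ⟶ cylObj F₁ F₂ Y)
  | _, _, .copy r f => (atEnd F₁ F₂ r).map (GA.val f)
  | _, _, .t X => H.t X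
  | _, _, .t' X => (H.inverse X).inv
  | _, _, .tHat X => (H.inverse X).hat
  | _, _, .tCheck X => (H.inverse X).check
  | _, _, .tBar X => (H.inverse X).bar
  | _, _, @CylGen.tGen _ _ X Y f => H.T X Y (GA.val f)

/-- The linear extension of `cylVal` to linear combinations of words. -/
noncomputable abbrev cylMap (X Y : A × Bool) :
    GA.toGradedQuiver.cyl.Lin k X Y →ₗ[k] (cylObj F₁ F₂ X ⟶ cylObj F₁ F₂ Y) :=
  FreeDG.evalLin k (Q := GA.toGradedQuiver.cyl) (cylObj F₁ F₂) (H.cylVal GA) X Y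

theorem cylMap_letter {X Y : A × Bool} (e : CylGen GA.toGradedQuiver X Y) :
    H.cylMap GA X Y (letter e) = H.cylVal GA e :=
  FreeDG.evalLin_single (Q := GA.toGradedQuiver.cyl) _ _ e

theorem cylMap_copyLin (r : Bool) {X Y : A} (x : GA.Lin k X Y) :
    H.cylMap GA (X, r) (Y, r) (copyLin r X Y x) =
      (atEnd F₁ F₂ r).map ((GA.expand X Y).symm x) := by
  refine lin_ext_apply (f := (H.cylMap GA (X, r) (Y, r)).comp (copyLin r X Y))
    (g := ((atEnd F₁ F₂ r).mapLinear X Y).comp (GA.expand X Y).symm.toLinearMap) (fun p => ?_) x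
  change H.cylMap GA _ _ (copyLin r X Y (word k p)) =
    (atEnd F₁ F₂ r).map ((GA.expand X Y).symm (word k p))
  rw [copyLin_word, GA.expand_symm_word, FreeDG.evalLin_word]
  clear x
  induction p with
  | nil => exact ((atEnd F₁ F₂ r).map_id X).symm
  | cons p e ih =>
    rw [copyWord, FreeDG.evalWord, ih, Word.eval]
    exact ((atEnd F₁ F₂ r).map_comp _ _).symm

/-- The recursion defining `tWord` is `T_comp` for a word followed by a letter; hence T is
determined by its values at generators. -/
theorem cylMap_tLin {X Y : A} (x : GA.Lin k X Y) :
    H.cylMap GA (X, false) (Y, true) (tLin X Y x) = H.T X Y ((GA.expand X Y).symm x) := by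
  refine lin_ext_apply (f := (H.cylMap GA (X, false) (Y, true)).comp (tLin X Y))
    (g := (H.T X Y).comp (GA.expand X Y).symm.toLinearMap) (fun p => ?_) x
  change H.cylMap GA _ _ (tLin X Y (word k p)) = H.T X Y ((GA.expand X Y).symm (word k p))
  rw [tLin_word, GA.expand_symm_word]
  clear x
  induction p with
  | nil =>
    have h := H.T_comp (𝟙 X) (DGCategory.id_mem (k := k) X)
    have h' : H.T X X (𝟙 X) = 0 := by simpa using h
    rw [tWord, _root_.map_zero]
    exact h'.symm
  | cons p e ih =>
    have h := H.cylMap_copyLin GA false (word k p)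
    rw [copyLin_word, GA.expand_symm_word] at h
    rw [tWord, _root_.map_add, Units.smul_def, map_zsmul, FreeDG.evalLin_mul, FreeDG.evalLin_mul,
      ih, cylMap_letter, cylMap_letter, h, Word.eval,
      H.T_comp _ (GA.eval_mem p), Units.smul_def]
    rfl

/-- The dg functor on the cylinder given by a homotopy. -/
noncomputable def toCyl : DGFunctor k GA.Cyl B :=
  FreeDG.lift GA.toDGQuiver.cylinder (cylObj F₁ F₂) (H.cylVal GA)
    (fun {X Y} e => by
      cases e with
      | copy r f => exact (atEnd F₁ F₂ r).map_mem (GA.val_mem f)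
      | t X => exact (H.t_mem X).1
      | t' X => exact (H.inverse X).inv_mem.1
      | tHat X => exact (H.inverse X).hat_mem
      | tCheck X => exact (H.inverse X).check_mem
      | tBar X => exact (H.inverse X).bar_mem
      | tGen f => exact H.T_mem (GA.val_mem f))
    (fun {X Y} e => by
      change _ = H.cylMap GA X Y (GA.toDGQuiver.cylDGen e)
      have h1 (Z : A × Bool) : H.cylMap GA Z Z (word k .nil) = 𝟙 (cylObj F₁ F₂ Z) :=
        FreeDG.evalLin_word _ _ _
      cases e with
      | copy r f =>
        rw [DGQuiver.cylDGen, cylMap_copyLin, LinearEquiv.symm_apply_apply]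
        exact ((atEnd F₁ F₂ r).map_d _).symm
      | t X =>
        rw [DGQuiver.cylDGen, _root_.map_zero]
        exact (mem_cocycles_iff.mp (H.t_mem X)).2
      | t' X =>
        rw [DGQuiver.cylDGen, _root_.map_zero]
        exact (mem_cocycles_iff.mp (H.inverse X).inv_mem).2
      | tHat X =>
        rw [DGQuiver.cylDGen, _root_.map_sub, FreeDG.evalLin_mul, cylMap_letter, cylMap_letter, h1]
        exact (H.inverse X).d_hat
      | tCheck X =>
        rw [DGQuiver.cylDGen, _root_.map_sub, FreeDG.evalLin_mul, cylMap_letter, cylMap_letter, h1]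
        exact (H.inverse X).d_check
      | tBar X =>
        rw [DGQuiver.cylDGen, _root_.map_sub, FreeDG.evalLin_mul, FreeDG.evalLin_mul]
        simp only [cylMap_letter]
        exact (H.inverse X).d_bar
      | @tGen X Y f =>
        rw [DGQuiver.cylDGen, _root_.map_add, Units.smul_def, map_zsmul, _root_.map_sub,
          FreeDG.evalLin_mul, FreeDG.evalLin_mul, cylMap_tLin, LinearEquiv.symm_apply_apply]
        simp only [cylMap_letter]
        exact H.d_T (GA.val_mem f))

theorem incl_comp_toCyl (r : Bool) : (GA.incl r).comp (H.toCyl GA) = atEnd F₁ F₂ r := by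
  have h : ((GA.incl r).comp (H.toCyl GA)).toFunctor = (atEnd F₁ F₂ r).toFunctor := by
    refine CategoryTheory.Functor.hext (fun X => rfl) (fun X Y f => heq_of_eq ?_)
    exact (H.cylMap_copyLin GA r _).trans (congrArg _ ((GA.expand X Y).symm_apply_apply f))
  -- The fields of a dg functor beyond its underlying functor are propositions.
  cases hF : atEnd F₁ F₂ r
  cases hF' : (GA.incl r).comp (H.toCyl GA)
  rw [hF, hF'] at h
  cases h
  rfl

theorem d_map_letter (K : DGFunctor k GA.Cyl B) {X Y : A × Bool}
    (e : CylGen GA.toGradedQuiver X Y) :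
    DGCategory.d (k := k) _ _ (K.map (X := ⟨X⟩) (Y := ⟨Y⟩) (letter (k := k) e)) =
      K.map (X := ⟨X⟩) (Y := ⟨Y⟩) (GA.toDGQuiver.cylDGen e) :=
  (K.map_d _).symm.trans (congrArg (K.map (X := ⟨X⟩) (Y := ⟨Y⟩)) (GA.toDGQuiver.diff_letter e))

/-- The homotopy given by a dg functor on the cylinder. -/
noncomputable def ofCyl (K : DGFunctor k GA.Cyl B) : Homotopy (GA.i₁.comp K) (GA.i₂.comp K) where
  t X := K.map (X := ⟨(X, false)⟩) (Y := ⟨(X, true)⟩) (letter (k := k) (.t X))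
  t_mem X := K.map_mem_cocycles (mem_cocycles_iff.mpr
    ⟨letter_mem (.t X), GA.toDGQuiver.diff_letter (.t X)⟩)
  inverse X :=
    { inv := K.map (X := ⟨(X, true)⟩) (Y := ⟨(X, false)⟩) (letter (k := k) (.t' X))
      hat := K.map (X := ⟨(X, false)⟩) (Y := ⟨(X, false)⟩) (letter (k := k) (.tHat X))
      check := K.map (X := ⟨(X, true)⟩) (Y := ⟨(X, true)⟩) (letter (k := k) (.tCheck X))
      bar := K.map (X := ⟨(X, false)⟩) (Y := ⟨(X, true)⟩) (letter (k := k) (.tBar X))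
      inv_mem := K.map_mem_cocycles (mem_cocycles_iff.mpr
        ⟨letter_mem (.t' X), GA.toDGQuiver.diff_letter (.t' X)⟩)
      hat_mem := K.map_mem (letter_mem (.tHat X))
      check_mem := K.map_mem (letter_mem (.tCheck X))
      bar_mem := K.map_mem (letter_mem (.tBar X))
      d_hat := (d_map_letter GA K (.tHat X)).trans ((K.map_sub _ _).trans
        (congrArg₂ (· - ·) (K.map_id _) (K.map_comp _ _)))
      d_check := (d_map_letter GA K (.tCheck X)).trans ((K.map_sub _ _).trans
        (congrArg₂ (· - ·) (K.map_id _) (K.map_comp _ _)))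
      d_bar := (d_map_letter GA K (.tBar X)).trans ((K.map_sub _ _).trans
        (congrArg₂ (· - ·) (K.map_comp _ _) (K.map_comp _ _))) }
  -- T f is K(t_f), where t_f is defined for every `f` through its expansion in words; `tLin_mul`
  -- and `diff_tLin` then give the rules for T.
  T X Y := (K.mapLinear ⟨(X, false)⟩ ⟨(Y, true)⟩).comp
    ((tLin X Y).comp (GA.expand X Y).toLinearMap)
  T_mem hf := K.map_mem (tLin_mem (GA.expand_mem hf))
  T_comp {X Y Z n f} g hf := by
    have h : tLin X Z (GA.expand X Z (f ≫ g)) = _ :=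
      (congrArg _ (GA.expand_comp f g)).trans (tLin_mul (GA.expand_mem hf) (GA.expand Y Z g))
    exact (congrArg (K.map (X := ⟨(X, false)⟩) (Y := ⟨(Z, true)⟩)) h).trans
      ((K.map_add _ _).trans (congrArg₂ (· + ·) (K.map_comp _ _)
        ((K.map_units_smul _ _).trans (congrArg _ (K.map_comp _ _)))))
  d_T {X Y n f} hf := by
    have h := GA.toDGQuiver.diff_tLin (GA.expand_mem hf)
    rw [DGQuiver.diff, ← GA.expand_d] at h
    exact (K.map_d _).symm.trans ((congrArg (K.map (X := ⟨(X, false)⟩) (Y := ⟨(Y, true)⟩)) h).trans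
      ((K.map_add _ _).trans (congrArg (· + _) ((K.map_units_smul _ _).trans (congrArg _
        ((K.map_sub _ _).trans (congrArg₂ (· - ·) (K.map_comp _ _) (K.map_comp _ _))))))))

end Homotopy

/-- The cylinder is free, so a functor on it is a choice of values at generators compatible with d;
these relations are those of a coherent inverse and of `d_T` at generators. The right-hand side does
not mention generators, so homotopies can be precomposed with functors and modified freely. -/
theorem homotopic_iff (GA : SemifreeGenerators k A) {F₁ F₂ : DGFunctor k A B} :
    Homotopic GA F₁ F₂ ↔ Nonempty (Homotopy F₁ F₂) := by
  constructor
  · rintro ⟨K, rfl, rfl⟩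
    exact ⟨.ofCyl GA K⟩
  · rintro ⟨H⟩
    exact ⟨H.toCyl GA, H.incl_comp_toCyl GA false, H.incl_comp_toCyl GA true⟩

end

end DGFunctor

end DG

/-! ### Homotopy invariance of cohomology and the theorem -/

namespace DG

namespace DGFunctor

section

variable {k : Type*} [CommRing k]
  {A : Type*} [Category* A] [Preadditive A] [Linear k A] [DGCategory k A]
  {B : Type*} [Category* B] [Preadditive B] [Linear k B] [DGCategory k B]

/-- A homotopy is natural on cocycles, up to coboundaries. -/
theorem Homotopy.naturality_mem {F₁ F₂ : DGFunctor k A B} (H : Homotopy F₁ F₂) {X Y : A} {n : ℤ}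
    {z : X ⟶ Y} (hz : z ∈ cocycles k X Y n) :
    H.t X ≫ F₂.map z - F₁.map z ≫ H.t Y ∈ coboundaries k (F₁.obj X) (F₂.obj Y) n := by
  have h := H.d_T hz.1
  rw [(mem_cocycles_iff.mp hz).2, _root_.map_zero, add_zero] at h
  refine ⟨n.negOnePow • H.T X Y z, units_smul_mem _ _ (H.T_mem hz.1), ?_⟩
  rw [d_units_smul, h, smul_smul, Int.units_mul_self, one_smul]

section

variable (F : DGFunctor k A A) (t : ∀ X, F.obj X ⟶ X) (ht : ∀ X, t X ∈ cocycles k (F.obj X) X 0)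
  (I : ∀ X, HomotopyInverse k (t X))
  (nat : ∀ {X Y : A} {n : ℤ} {z : X ⟶ Y}, z ∈ cocycles k X Y n →
    t X ≫ z - F.map z ≫ t Y ∈ coboundaries k (F.obj X) Y n)

include ht I nat

/-- If F z is exact, so is t ≫ z, by naturality; composing with the inverse of t on the left
recovers z up to a coboundary. -/
theorem mapCohomology_injective_of_natural (X Y : A) (n : ℤ) :
    Function.Injective (F.mapCohomology X Y n) := by
  rw [mapCohomology_injective_iff]
  intro z hz hFz
  have h2 := add_mem (nat hz) (coboundary_comp_cocycle hFz (ht Y))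
  have h3 := add_mem (cocycle_comp_coboundary (I X).inv_mem h2)
    (coboundary_zero_comp_cocycle (I X).inv_comp_mem hz)
  convert h3 using 1
  simp

/-- A preimage of the class of y is the conjugate z = t⁻¹ ≫ y ≫ t: naturality gives F z ≫ t ~ t ≫ z
~ y ≫ t, and t can be cancelled on the right. -/
theorem mapCohomology_surjective_of_natural (X Y : A) (n : ℤ) :
    Function.Surjective (F.mapCohomology X Y n) := by
  rw [mapCohomology_surjective_iff]
  intro y hy
  have hyt : y ≫ t Y ∈ cocycles k (F.obj X) Y n := comp_mem_cocycles' hy (ht Y) (add_zero n)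
  have hz : (I X).inv ≫ y ≫ t Y ∈ cocycles k X Y n :=
    comp_mem_cocycles' (I X).inv_mem hyt (zero_add n)
  have hFz : F.map ((I X).inv ≫ y ≫ t Y) ∈ cocycles k (F.obj X) (F.obj Y) n :=
    F.map_mem_cocycles hz
  refine ⟨_, hz, ?_⟩
  have h2 := add_mem (nat hz) (coboundary_zero_comp_cocycle (I X).comp_inv_mem hyt)
  have h3 := sub_mem (cocycle_comp_coboundary_zero (sub_mem hFz hy) (I Y).comp_inv_mem)
    (coboundary_comp_cocycle h2 (I Y).inv_mem)
  convert h3 using 1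
  simp
  abel

end

theorem Homotopy.mapCohomology_bijective {F : DGFunctor k A A}
    (H : Homotopy F (DGFunctor.id k A)) (X Y : A) (n : ℤ) :
    Function.Bijective (F.mapCohomology X Y n) :=
  ⟨mapCohomology_injective_of_natural F H.t H.t_mem H.inverse H.naturality_mem X Y n,
    mapCohomology_surjective_of_natural F H.t H.t_mem H.inverse H.naturality_mem X Y n⟩

/-- Closed morphisms of degree zero with a homotopy inverse are isomorphisms in `H^0`. -/
theorem nonempty_iso {X Y : A} {t : X ⟶ Y} (ht : t ∈ cocycles k X Y 0) (I : HomotopyInverse k t) :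
    Nonempty ((⟨⟨X⟩⟩ : H0 k A) ≅ ⟨⟨Y⟩⟩) :=
  ⟨{ hom := (CategoryTheory.Quotient.functor (cohomologous k A)).map
        (X := ⟨X⟩) (Y := ⟨Y⟩) ⟨t, ht⟩
     inv := (CategoryTheory.Quotient.functor (cohomologous k A)).map
        (X := ⟨Y⟩) (Y := ⟨X⟩) ⟨I.inv, I.inv_mem⟩
     hom_inv_id := by
       rw [← Functor.map_comp]
       refine (CategoryTheory.Quotient.sound _ ?_).symm
       exact I.comp_inv_mem
     inv_hom_id := by
       rw [← Functor.map_comp]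
       refine (CategoryTheory.Quotient.sound _ ?_).symm
       exact I.inv_comp_mem }⟩

/-- Isomorphisms in `H^0` are represented by morphisms with a homotopy inverse. -/
theorem exists_homotopyInverse_of_iso {X Y : A} (i : (⟨⟨X⟩⟩ : H0 k A) ≅ ⟨⟨Y⟩⟩) :
    ∃ t ∈ cocycles k X Y 0, Nonempty (HomotopyInverse k t) := by
  obtain ⟨t, ht⟩ := (CategoryTheory.Quotient.functor (cohomologous k A)).map_surjective
    (X := (⟨X⟩ : Z0 k A)) (Y := (⟨Y⟩ : Z0 k A)) i.hom
  obtain ⟨t', ht'⟩ := (CategoryTheory.Quotient.functor (cohomologous k A)).map_surjective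
    (X := (⟨Y⟩ : Z0 k A)) (Y := (⟨X⟩ : Z0 k A)) i.inv
  refine ⟨t.1, t.2, nonempty_homotopyInverse t.2 t'.2 ?_ ?_⟩
  · refine (CategoryTheory.Quotient.functor_map_eq_iff (cohomologous k A) (𝟙 _) (t ≫ t')).mp ?_
    rw [Functor.map_comp, ht, ht', i.hom_inv_id]
    rfl
  · refine (CategoryTheory.Quotient.functor_map_eq_iff (cohomologous k A) (𝟙 _) (t' ≫ t)).mp ?_
    rw [Functor.map_comp, ht, ht', i.inv_hom_id]
    rfl

/-- Both composites are bijective on cohomology. Injectivity of F follows from that of GF. For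
surjectivity, GF reaches the class of G y at some x, and injectivity of FG, hence of G, gives F x ~
y. -/
theorem isQuasiEquivalence_of_homotopy {F : DGFunctor k A B} {G : DGFunctor k B A}
    (H : Homotopy (F.comp G) (DGFunctor.id k A)) (K : Homotopy (G.comp F) (DGFunctor.id k B)) :
    F.IsQuasiEquivalence where
  bijective X Y n := by
    refine ⟨(F.mapCohomology_injective_iff X Y n).mpr fun z hz hFz => ?_,
      (F.mapCohomology_surjective_iff X Y n).mpr fun y hy => ?_⟩
    · exact ((F.comp G).mapCohomology_injective_iff X Y n).mp (H.mapCohomology_bijective X Y n).1 z hz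
        (G.map_mem_coboundaries hFz)
    · obtain ⟨x, hx, hxy⟩ := ((F.comp G).mapCohomology_surjective_iff X Y n).mp
        (H.mapCohomology_bijective X Y n).2 (G.map y) (G.map_mem_cocycles hy)
      refine ⟨x, hx, ((G.comp F).mapCohomology_injective_iff (F.obj X) (F.obj Y) n).mp
        (K.mapCohomology_bijective _ _ n).1 _ (sub_mem (F.map_mem_cocycles hx) hy)
        (F.map_mem_coboundaries (f := G.map (F.map x - y)) ?_)⟩
      rw [G.map_sub]
      exact hxy
  essSurj := ⟨fun Y => by
    obtain ⟨⟨Y⟩⟩ := Y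
    exact ⟨⟨⟨G.obj Y⟩⟩, nonempty_iso (K.t_mem Y) (K.inverse Y)⟩⟩

theorem IsQuasiEquivalence.exists_homotopy (GA : SemifreeGenerators k A)
    (GB : SemifreeGenerators k B) {F : DGFunctor k A B} (hF : F.IsQuasiEquivalence) :
    ∃ G : DGFunctor k B A, Nonempty (Homotopy (F.comp G) (DGFunctor.id k A)) ∧
      Nonempty (Homotopy (G.comp F) (DGFunctor.id k B)) := by
  have h : ∀ Y : B, ∃ (X : A) (t : F.obj X ⟶ Y), t ∈ cocycles k (F.obj X) Y 0 ∧
      Nonempty (HomotopyInverse k t) := by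
    intro Y
    obtain ⟨⟨⟨X⟩⟩, ⟨i⟩⟩ := hF.essSurj.mem_essImage ⟨⟨Y⟩⟩
    obtain ⟨t, ht, I⟩ := exists_homotopyInverse_of_iso (X := F.obj X) (Y := Y) i
    exact ⟨X, t, ht, I⟩
  choose o t ht I using h
  obtain ⟨G, ⟨K⟩⟩ := exists_homotopy_comp_id GB F hF.bijective o t ht fun Y => (I Y).some
  -- `K.whiskerLeft F` is a homotopy FGF ≈ F, that is, between the composites with F of GF and of
  -- the identity; it is lifted along F.
  exact ⟨G, nonempty_homotopy_of_comp GA F hF.bijective (K.whiskerLeft F), ⟨K⟩⟩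

end

end DGFunctor

end DG

theorem mainTheorem5 {k : Type u₃} [CommRing k]
    {A : Type u₁} [Category.{v₁} A] [Preadditive A] [Linear k A] [DG.DGCategory k A]
    {B : Type u₂} [Category.{v₂} B] [Preadditive B] [Linear k B] [DG.DGCategory k B]
    (GA : DG.SemifreeGenerators.{w₁} k A) (GB : DG.SemifreeGenerators.{w₂} k B)
    (F : DG.DGFunctor k A B) :
    F.IsHomotopyEquivalence GA GB ↔ F.IsQuasiEquivalence := by
  simp only [DG.DGFunctor.IsHomotopyEquivalence, DG.DGFunctor.homotopic_iff]
  constructor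
  · rintro ⟨G, ⟨H⟩, ⟨K⟩⟩
    exact DG.DGFunctor.isQuasiEquivalence_of_homotopy H K
  · intro hF
    exact hF.exists_homotopy GA GB
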